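/- Let $\mu>0$, let $\xi$ be a complex space-time white noise on $\mathbf{R}\times\mathbf{T}^3$, $\mathbf{T}^3=(\mathbf{R}/\mathbf{Z})^3$ (a jointly isotropic complex normal family $\xi(\varphi)$ with $\boldsymbol E[\xi(\varphi)\overline{\xi(\psi)}]=\int\varphi\overline{\psi}$), and let $\hat\xi(k)$, $k\in\mathbf{Z}^3$, be its spatial Fourier coefficients. Put $e_k(x)=e^{2\pi\mathsf{i}k\cdot x}$, $h(s,k)=e^{-\{4\pi^2(\mathsf{i}+\mu)|k|^2+1\}s}$, $P^1_s=e^{s\{(\mathsf{i}+\mu)\triangle-1\}}$ (so $P^1_se_k=h(s,k)e_k$) and $I(v)_t=\int_{-\infty}^tP^1_{t-s}v_s\,ds$. Let $\chi:\mathbf{R}^3\to\mathbf{R}$ be smooth with $\operatorname{supp}\chi\subset B(0,1)$ and $\chi(0)=1$, let $0<\epsilon<1$, $\chi^\epsilon(k)=\chi(\epsilon k)$, $\chi^\epsilon(k,l)=\chi^\epsilon(k)\chi^\epsilon(l)$, and $$Z^\epsilon_t=\sum_{k\in\mathbf{Z}^3}\chi^\epsilon(k)\Big(\int_{-\infty}^th(t-s,k)\,\hat\xi_s(k)\,ds\Big)e_k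 ,$$ where the stochastic integrals are taken in a version that is jointly measurable in time and chance. Let $\{\rho_m\}_{m\ge-1}$ be a dyadic partition of unity on $\mathbf{R}^3$: the $\rho_m:\mathbf{R}^3\to[0,1]$ are radial and smooth, $\operatorname{supp}\rho_{-1}\subset B(0,\frac43)$, $\operatorname{supp}\rho_0\subset B(0,\frac83)\setminus B(0,\frac34)$, $\rho_m=\rho_0(2^{-m}\cdot)$ for $m\ge0$, and $\sum_{m\ge-1}\rho_m=1$. Write $\triangle_mf=\sum_k\rho_m(k)\hat f(k)e_k$ and $f\odot g=\sum_{|m_1-m_2|\le1}\triangle_{m_1}f\,\triangle_{m_2}g$. For $t\in\mathbf{R}$, $x\in\mathbf{T}^3$ define $$c_1^\epsilon=\boldsymbol E\big[Z^\epsilon_t(x)\overline{Z^\epsilon_t(x)}\big],\qquad c_{2,1}^\epsilon=\tfrac12\boldsymbol E\big[\big(I((Z^\epsilon)^2)_t\odot(\overline{Z^\epsilon_t})^2\big)(x)\big],$$ $$c_{2,2}^\epsilon=\boldsymbol E\big[\big(I(Z^\epsilon\overline{Z^\epsilon}-c_1^\epsilon)_t\odot(Z^\epsilon_t\overline{Z^\epsilon_t}-c_1^\epsilon)\big)(x)\big].$$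 Then the random variables inside these expectations are integrable, and $$c_1^\epsilon=\sum_{k\in\mathbf{Z}^3}\frac{\chi^\epsilon(k)^2}{2(4\pi^2\mu|k|^2+1)},$$ $$c_{2,1}^\epsilon=\sum_{k_1,k_2\in\mathbf{Z}^3}\frac{\chi^\epsilon(k_1,k_2)^2}{4(4\pi^2\mu|k_1|^2+1)(4\pi^2\mu|k_2|^2+1)(\alpha_1+\mathsf{i}\beta_1)},$$ $$c_{2,2}^\epsilon=\sum_{k_1,l_1\in\mathbf{Z}^3}\frac{\chi^\epsilon(k_1,l_1)^2}{4(4\pi^2\mu|k_1|^2+1)(4\pi^2\mu|l_1|^2+1)(\alpha_2+\mathsf{i}\beta_2)},$$ where $$\alpha_1=4\pi^2\mu(|k_1+k_2|^2+|k_1|^2+|k_2|^2)+3,\qquad\beta_1=4\pi^2(|k_1+k_2|^2-|k_1|^2-|k_2|^2),$$ $$\alpha_2=4\pi^2\mu(|k_1-l_1|^2+|k_1|^2+|l_1|^2)+3,\qquad\beta_2=4\pi^2(|k_1-l_1|^2-|k_1|^2+|l_1|^2).$$ In particular the three constants do not depend on $(t,x)$ or on the dyadic partition of unity. -/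

import Mathlib

open MeasureTheory ProbabilityTheory UnitAddTorus
open scoped ComplexConjugate NNReal

noncomputable section

namespace CGL

/-- The three-dimensional torus `(ℝ/ℤ)³`. -/
abbrev T3 : Type := UnitAddTorus (Fin 3)

/-- The lattice `ℤ³` of frequencies. -/
abbrev Z3 : Type := Fin 3 → ℤ

/-- The Euclidean space `ℝ³`. -/
abbrev R3 : Type := EuclideanSpace ℝ (Fin 3)

/-- The normalised Haar (Lebesgue) measure on the torus; this is the measure used in
`UnitAddTorus.mFourierCoeff`. -/
def torusMeasure : Measure T3 :=
  Measure.pi (fun _ : Fin 3 => (AddCircle.haarAddCircle : Measure UnitAddCircle))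

/-- Lebesgue measure on `ℝ × 𝕋³`. -/
def spaceTimeMeasure : Measure (ℝ × T3) := (volume : Measure ℝ).prod torusMeasure

/-- A lattice point seen as a vector of `ℝ³`. -/
def toR3 (k : Z3) : R3 := WithLp.toLp 2 (fun i => (k i : ℝ))

/-- `|k|²` for `k ∈ ℤ³`. -/
def normSq (k : Z3) : ℝ := ∑ i, (k i : ℝ) ^ 2

/-! ### Complex white noise -/

/-- A complex random variable is isotropic complex normal if its real and imaginary parts are
independent centred real Gaussians with the same variance (possibly zero). -/
def IsIsotropicComplexNormal {Ω : Type*} [MeasurableSpace Ω] (P : Measure Ω) (X : Ω → ℂ) : Prop :=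
  Measurable X ∧ ∃ v : ℝ≥0,
    P.map (fun ω => ((X ω).re, (X ω).im)) = (gaussianReal 0 v).prod (gaussianReal 0 v)

/-- Complex space-time white noise on `ℝ × 𝕋³`. Here `ξ φ` is the random variable
`∫ ξ(t,x) φ(t,x) dt dx` for a (complex valued) square integrable `φ`. The noise is jointly
isotropic complex normal (so that in particular `E[ξ(φ) ξ(ψ)] = 0`) and
`E[ξ(φ) conj (ξ(ψ))] = ∫ φ conj ψ`. -/
structure IsComplexWhiteNoise {Ω : Type*} [MeasurableSpace Ω] (P : Measure Ω)
    (ξ : (ℝ × T3 → ℂ) → Ω → ℂ) : Prop where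
  jointly_isotropic : ∀ (n : ℕ) (φ : Fin n → ℝ × T3 → ℂ) (c : Fin n → ℂ),
    (∀ i, MemLp (φ i) 2 spaceTimeMeasure) →
      IsIsotropicComplexNormal P (fun ω => ∑ i, c i * ξ (φ i) ω)
  covariance : ∀ φ ψ : ℝ × T3 → ℂ,
    MemLp φ 2 spaceTimeMeasure → MemLp ψ 2 spaceTimeMeasure →
      ∫ ω, ξ φ ω * conj (ξ ψ ω) ∂P = ∫ p, φ p * conj (ψ p) ∂spaceTimeMeasure

/-- The Fourier coefficient `ξ̂(k)` of the noise in the space variable: a noise on `ℝ`, with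
`∫ f(s) ξ̂_s(k) ds = ξ(f ⊗ e_{-k})`. -/
def noiseFourier {Ω : Type*} (ξ : (ℝ × T3 → ℂ) → Ω → ℂ) (k : Z3) (f : ℝ → ℂ) : Ω → ℂ :=
  ξ (fun p => f p.1 * mFourier (-k) p.2)

/-! ### The semigroup `P¹`, the operator `I` and the stochastic convolution -/

/-- `h(s,k) = exp(-(4π²(i+μ)|k|²+1)s)`, the Fourier multiplier of
`P¹_s = exp(s((i+μ)Δ-1))`. -/
def h (μ s : ℝ) (k : Z3) : ℂ :=
  Complex.exp (-((4 * Real.pi ^ 2 * (Complex.I + μ) * normSq k + 1) * s))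

/-- `P¹_s f`. -/
def heat (μ s : ℝ) (f : T3 → ℂ) : T3 → ℂ :=
  fun x => ∑' k : Z3, h μ s k * mFourierCoeff f k * mFourier k x

/-- `I(v)_t = ∫_{-∞}^t P¹_{t-s} v_s ds`. -/
def duhamel (μ : ℝ) (v : ℝ → T3 → ℂ) : ℝ → T3 → ℂ :=
  fun t x => ∫ s in Set.Iic t, heat μ (t - s) (v s) x

/-- The stochastic integral `∫_{-∞}^t h(t-s,k) ξ̂_s(k) ds`. -/
def stochConv {Ω : Type*} (μ : ℝ) (ξ : (ℝ × T3 → ℂ) → Ω → ℂ) (k : Z3) (t : ℝ) : Ω → ℂ :=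
  noiseFourier ξ k ((Set.Iic t).indicator (fun s => h μ (t - s) k))

/-- `z` is a version, jointly measurable in time and chance, of the family of stochastic integrals
`∫_{-∞}^t h(t-s,k) ξ̂_s(k) ds`; each of these is by itself only defined up to a null set. -/
structure IsStochConvVersion {Ω : Type*} [MeasurableSpace Ω] (P : Measure Ω) (μ : ℝ)
    (ξ : (ℝ × T3 → ℂ) → Ω → ℂ) (z : Z3 → ℝ → Ω → ℂ) : Prop where
  measurable : ∀ k, Measurable (fun p : ℝ × Ω => z k p.1 p.2)
  ae_eq : ∀ k t, z k t =ᵐ[P] stochConv μ ξ k t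

/-! ### Mollifier, dyadic partitions of unity, resonant product -/

/-- `χ` is smooth on `ℝ³`, supported in the open unit ball, and `χ(0) = 1`. -/
structure IsCutoff (χ : R3 → ℝ) : Prop where
  smooth : ContDiff ℝ (⊤ : ℕ∞) χ
  support : tsupport χ ⊆ Metric.ball 0 1
  map_zero : χ 0 = 1

/-- `χ^ε(k) = χ(εk)`. -/
def chiEps (χ : R3 → ℝ) (ε : ℝ) (k : Z3) : ℝ := χ (ε • toR3 k)

/-- A dyadic partition of unity `(ρ_m)_{m ≥ -1}` on `ℝ³`. The index is shifted by one:
`ρ 0` stands for `ρ_{-1}` and `ρ (m + 1)` stands for `ρ_m`, `m ≥ 0`. -/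
structure IsDyadicPartition (ρ : ℕ → R3 → ℝ) : Prop where
  mem_Icc : ∀ m y, ρ m y ∈ Set.Icc (0 : ℝ) 1
  smooth : ∀ m, ContDiff ℝ (⊤ : ℕ∞) (ρ m)
  radial : ∀ m y y', ‖y‖ = ‖y'‖ → ρ m y = ρ m y'
  support_neg_one : tsupport (ρ 0) ⊆ Metric.ball 0 (4 / 3)
  support_zero : tsupport (ρ 1) ⊆ Metric.ball 0 (8 / 3) \ Metric.ball 0 (3 / 4)
  scaling : ∀ (m : ℕ) (y : R3), ρ (m + 1) y = ρ 1 (((2 : ℝ) ^ m)⁻¹ • y)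
  sum_eq_one : ∀ y, HasSum (fun m => ρ m y) 1

/-- The Littlewood-Paley block `Δ_m f = ρ_m(D) f` (index shifted by one as above). -/
def lpBlock (ρ : ℕ → R3 → ℝ) (m : ℕ) (f : T3 → ℂ) : T3 → ℂ :=
  fun x => ∑' k : Z3, (ρ m (toR3 k) : ℂ) * mFourierCoeff f k * mFourier k x

/-- The resonant product `∑_{|m₁ - m₂| ≤ 1} Δ_{m₁} f Δ_{m₂} g`. -/
def resonant (ρ : ℕ → R3 → ℝ) (f g : T3 → ℂ) : T3 → ℂ :=
  fun x => ∑' m : {m : ℕ × ℕ // m.1 ≤ m.2 + 1 ∧ m.2 ≤ m.1 + 1},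
    lpBlock ρ m.1.1 f x * lpBlock ρ m.1.2 g x

/-! ### The drivers and the renormalization constants

A circle is denoted `A` (the process `Z^ε`), a square `B` (its conjugate), and `I` is `duhamel`. -/

section Drivers

variable {Ω : Type*} [MeasurableSpace Ω] (P : Measure Ω) (μ : ℝ) (χ : R3 → ℝ) (ε : ℝ)
  (z : Z3 → ℝ → Ω → ℂ) (ρ : ℕ → R3 → ℝ)

/-- `Z^ε_t(x) = ∑_k χ^ε(k) (∫_{-∞}^t h(t-s,k) ξ̂_s(k) ds) e_k(x)`. -/
def XA (ω : Ω) (t : ℝ) (x : T3) : ℂ :=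
  ∑' k : Z3, (chiEps χ ε k : ℂ) * z k t ω * mFourier k x

/-- The complex conjugate of `Z^ε`. -/
def XB (ω : Ω) (t : ℝ) (x : T3) : ℂ := conj (XA χ ε z ω t x)

/-- The constant `c₁^ε`, as defined by means of the point `(t,x)`. -/
def c1 (t : ℝ) (x : T3) : ℂ := ∫ ω, XA χ ε z ω t x * XB χ ε z ω t x ∂P

/-- `(Z^ε)²`. -/
def XAA (ω : Ω) (t : ℝ) (x : T3) : ℂ := XA χ ε z ω t x ^ 2

/-- `Z^ε conj(Z^ε) - c₁^ε`. -/
def XAB (ω : Ω) (t : ℝ) (x : T3) : ℂ :=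
  XA χ ε z ω t x * XB χ ε z ω t x - c1 P χ ε z t x

/-- `conj(Z^ε)²`. -/
def XBB (ω : Ω) (t : ℝ) (x : T3) : ℂ := XB χ ε z ω t x ^ 2

/-- `I((Z^ε)²)`. -/
def XIAA (ω : Ω) : ℝ → T3 → ℂ := duhamel μ (XAA χ ε z ω)

/-- `I(Z^ε conj(Z^ε) - c₁^ε)`. -/
def XIAB (ω : Ω) : ℝ → T3 → ℂ := duhamel μ (XAB P χ ε z ω)

/-- The resonant product of `I((Z^ε)²)` and `conj(Z^ε)²` at `(t,x)`. -/
def resIAABB (t : ℝ) (x : T3) (ω : Ω) : ℂ :=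
  resonant ρ (XIAA μ χ ε z ω t) (XBB χ ε z ω t) x

/-- The resonant product of `I(Z^ε conj(Z^ε) - c₁^ε)` and `Z^ε conj(Z^ε) - c₁^ε` at `(t,x)`. -/
def resIABAB (t : ℝ) (x : T3) (ω : Ω) : ℂ :=
  resonant ρ (XIAB P μ χ ε z ω t) (XAB P χ ε z ω t) x

/-- The constant `c_{2,1}^ε`, as defined by means of `(t,x)` and the partition `ρ`. -/
def c21 (t : ℝ) (x : T3) : ℂ := (1 / 2) * ∫ ω, resIAABB μ χ ε z ρ t x ω ∂P

/-- The constant `c_{2,2}^ε`, as defined by means of `(t,x)` and the partition `ρ`. -/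
def c22 (t : ℝ) (x : T3) : ℂ := ∫ ω, resIABAB P μ χ ε z ρ t x ω ∂P

end Drivers

/-! ### The quadratic forms in the lattice sums -/

def α₁ (μ : ℝ) (k₁ k₂ : Z3) : ℝ :=
  4 * Real.pi ^ 2 * μ * (normSq (k₁ + k₂) + normSq k₁ + normSq k₂) + 3

def β₁ (k₁ k₂ : Z3) : ℝ := 4 * Real.pi ^ 2 * (normSq (k₁ + k₂) - normSq k₁ - normSq k₂)

def α₂ (μ : ℝ) (k₁ l₁ : Z3) : ℝ :=
  4 * Real.pi ^ 2 * μ * (normSq (k₁ - l₁) + normSq k₁ + normSq l₁) + 3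

def β₂ (k₁ l₁ : Z3) : ℝ := 4 * Real.pi ^ 2 * (normSq (k₁ - l₁) - normSq k₁ + normSq l₁)

end CGL

end

namespace CGL

/-! ### Gaussian moments -/

/-! Since `χ` has support in the unit ball, only finitely many modes survive the cutoff, and `Z^ε`
is a trigonometric polynomial whose random coefficients are, up to null sets, in the linear span of
the noise. Every operator involved therefore acts term by term on exponentials; the resonant product
of two of them only inserts the scalar `resSymb ρ k l`, the sum of `ρ_m(k) ρ_m'(l)` over `|m - m'| ≤
1`.

Three facts then give the formulas. The covariance of two modes at times `s ≤ t` vanishes unless the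
frequencies agree, and otherwise decays exponentially in `t - s` (`integral_stochConv_mul_conj`).
Wick's formula (`wick_formula`) reduces fourth moments to these covariances. It leaves only pairs of
opposite output frequencies, where `resSymb` is `1` (`resSymb_neg`) and the exponentials multiply to
`1`, so that `ρ` and `x` disappear. What remains after Fubini (`integral_resonant_duhamel`) is an
exponential integral over `(-∞, t]`, whose value is the reciprocal of `α + iβ`.

For `c_{2,1}` both Wick pairings contribute equally, which cancels the prefactor `1/2`. For
`c_{2,2}` subtracting `c₁` removes one pairing and the other survives. -/

theorem integrable_pow_gaussianReal (v : ℝ≥0) (n : ℕ) :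
    Integrable (fun x : ℝ => x ^ n) (gaussianReal 0 v) := by
  rcases Nat.eq_zero_or_pos n with rfl | hn
  · simp
  · have h := (memLp_id_gaussianReal (μ := 0) (v := v) n).integrable_norm_pow (p := n) hn.ne'
    rw [← integrable_norm_iff (by fun_prop)]
    simpa using h

theorem integral_sq_gaussianReal (v : ℝ≥0) : ∫ x : ℝ, x ^ 2 ∂gaussianReal 0 v = v := by
  have h := variance_id_gaussianReal (μ := 0) (v := v)
  rw [variance_eq_integral (by fun_prop)] at h
  simpa using h

/-- The law with variance `2v` is both the image of the one with variance `v` under scaling by `√2`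
and its convolution square. Computing the fourth moment `m` both ways gives `4m = 2m + 6v²`. -/
theorem integral_pow_four_gaussianReal (v : ℝ≥0) :
    ∫ x : ℝ, x ^ 4 ∂gaussianReal 0 v = 3 * (v : ℝ) ^ 2 := by
  have hI := fun n => integrable_pow_gaussianReal v n
  have h1 : ∫ x : ℝ, x ^ 4 ∂gaussianReal 0 (v + v) = 4 * ∫ x : ℝ, x ^ 4 ∂gaussianReal 0 v := by
    have hm : gaussianReal 0 (v + v) =
        (gaussianReal 0 v).map (fun x => Real.sqrt 2 * x) := by
      rw [gaussianReal_map_const_mul]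
      congr 1
      · simp
      · ext; simp; ring
    rw [hm, integral_map (by fun_prop) (by fun_prop), ← integral_const_mul]
    congr 1
    ext x
    rw [mul_pow, show Real.sqrt 2 ^ 4 = (Real.sqrt 2 ^ 2) ^ 2 by ring, Real.sq_sqrt (by norm_num)]
    norm_num
  have h2 : ∫ x : ℝ, x ^ 4 ∂gaussianReal 0 (v + v) =
      2 * (∫ x : ℝ, x ^ 4 ∂gaussianReal 0 v) + 6 * (v : ℝ) ^ 2 := by
    have hm : gaussianReal 0 (v + v) = (gaussianReal 0 v) ∗ (gaussianReal 0 v) := by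
      rw [gaussianReal_conv_gaussianReal, add_zero]
    have hint := integrable_pow_gaussianReal (v + v) 4
    rw [hm] at hint ⊢
    rw [integral_conv hint]
    have hinner : ∀ x : ℝ, ∫ y : ℝ, (x + y) ^ 4 ∂gaussianReal 0 v =
        x ^ 4 + 4 * x ^ 3 * (∫ y : ℝ, y ∂gaussianReal 0 v) + 6 * x ^ 2 * v
          + 4 * x * (∫ y : ℝ, y ^ 3 ∂gaussianReal 0 v) + ∫ y : ℝ, y ^ 4 ∂gaussianReal 0 v := by
      intro x
      have hx : ∀ y : ℝ, (x + y) ^ 4 =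
          x ^ 4 * y ^ 0 + 4 * x ^ 3 * y ^ 1 + 6 * x ^ 2 * y ^ 2 + 4 * x * y ^ 3 + y ^ 4 := by
        intro y; ring
      have e := fun (c : ℝ) (n : ℕ) => (hI n).const_mul c
      simp_rw [hx]
      rw [integral_add (((((e _ _).fun_add (e _ _)).fun_add (e _ _)).fun_add (e _ _))) (hI 4),
        integral_add ((((e _ _).fun_add (e _ _)).fun_add (e _ _))) (e _ _),
        integral_add (((e _ _).fun_add (e _ _))) (e _ _), integral_add (e _ _) (e _ _)]
      simp only [integral_const_mul, integral_sq_gaussianReal]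
      simp
    simp_rw [hinner, integral_id_gaussianReal]
    have e := fun (c : ℝ) (n : ℕ) => (hI n).const_mul c
    have hx : ∀ x : ℝ, x ^ 4 + 4 * x ^ 3 * 0 + 6 * x ^ 2 * v
          + 4 * x * (∫ y : ℝ, y ^ 3 ∂gaussianReal 0 v) + ∫ y : ℝ, y ^ 4 ∂gaussianReal 0 v =
        x ^ 4 + (6 * v) * x ^ 2 + (4 * ∫ y : ℝ, y ^ 3 ∂gaussianReal 0 v) * x ^ 1
          + (∫ y : ℝ, y ^ 4 ∂gaussianReal 0 v) * x ^ 0 := by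
      intro x; ring
    simp_rw [hx]
    rw [integral_add ((((hI 4).fun_add (e _ _)).fun_add (e _ _))) (e _ _),
      integral_add (((hI 4).fun_add (e _ _))) (e _ _), integral_add (hI 4) (e _ _)]
    simp only [integral_const_mul, integral_sq_gaussianReal]
    simp only [pow_one, integral_id_gaussianReal]
    simp
    ring
  linarith

/-! ### Isotropic complex normal variables -/

section Isotropic

variable {Ω : Type*} [MeasurableSpace Ω] {P : Measure Ω}

theorem IsIsotropicComplexNormal.memLp {X : Ω → ℂ} (hX : IsIsotropicComplexNormal P X)
    (p : ℝ≥0) : MemLp X p P := by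
  obtain ⟨hm, v, hv⟩ := hX
  have hT : AEMeasurable (fun ω => ((X ω).re, (X ω).im)) P := by fun_prop
  have h1 : MemLp (fun q : ℝ × ℝ => q.1) p ((gaussianReal 0 v).prod (gaussianReal 0 v)) :=
    (memLp_id_gaussianReal (μ := 0) (v := v) p).comp_fst _
  have h2 : MemLp (fun q : ℝ × ℝ => q.2) p ((gaussianReal 0 v).prod (gaussianReal 0 v)) :=
    (memLp_id_gaussianReal (μ := 0) (v := v) p).comp_snd _
  rw [← hv, memLp_map_measure_iff (by fun_prop) hT] at h1 h2
  exact memLp_re_im_iff.1 ⟨h1, h2⟩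

/-- With independent real and imaginary parts of variance `v`, the second absolute moment is `2v`
and the fourth is `3v² + 3v² + 2v² = 8v²`. This is the diagonal case of Wick's formula. -/
theorem IsIsotropicComplexNormal.integral_normSq_sq {X : Ω → ℂ}
    (hX : IsIsotropicComplexNormal P X) :
    ∫ ω, X ω * X ω * conj (X ω) * conj (X ω) ∂P = 2 * (∫ ω, X ω * conj (X ω) ∂P) ^ 2 := by
  obtain ⟨hm, v, hv⟩ := hX
  have hT : AEMeasurable (fun ω => ((X ω).re, (X ω).im)) P := by fun_prop
  have hI := fun n => integrable_pow_gaussianReal v n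
  have e := fun (n m : ℕ) => (hI n).mul_prod (hI m)
  have h2 : ∫ ω, X ω * conj (X ω) ∂P = ((2 * v : ℝ) : ℂ) := by
    have h : ∀ ω, X ω * conj (X ω) = (((X ω).re ^ 2 + (X ω).im ^ 2 : ℝ) : ℂ) := by
      intro ω; rw [Complex.mul_conj, Complex.normSq_apply]; congr 1; ring
    simp_rw [h]
    rw [integral_complex_ofReal]
    congr 1
    have := integral_map (μ := P) hT (f := fun q : ℝ × ℝ => q.1 ^ 2 + q.2 ^ 2) (by fun_prop)
    rw [← this, hv]
    have hx : ∀ q : ℝ × ℝ, q.1 ^ 2 + q.2 ^ 2 = q.1 ^ 2 * q.2 ^ 0 + q.1 ^ 0 * q.2 ^ 2 := by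
      intro q; ring
    simp_rw [hx]
    rw [integral_add (e _ _) (e _ _), integral_prod_mul (fun x : ℝ => x ^ 2) (fun x : ℝ => x ^ 0),
      integral_prod_mul (fun x : ℝ => x ^ 0) (fun x : ℝ => x ^ 2), integral_sq_gaussianReal]
    simp
    ring
  have h4 : ∫ ω, X ω * X ω * conj (X ω) * conj (X ω) ∂P = ((8 * v ^ 2 : ℝ) : ℂ) := by
    have h : ∀ ω, X ω * X ω * conj (X ω) * conj (X ω) =
        ((((X ω).re ^ 2 + (X ω).im ^ 2) ^ 2 : ℝ) : ℂ) := by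
      intro ω
      have : X ω * X ω * conj (X ω) * conj (X ω) = (X ω * conj (X ω)) ^ 2 := by ring
      rw [this, Complex.mul_conj, Complex.normSq_apply, ← Complex.ofReal_pow]; congr 1; ring
    simp_rw [h]
    rw [integral_complex_ofReal]
    congr 1
    have := integral_map (μ := P) hT (f := fun q : ℝ × ℝ => (q.1 ^ 2 + q.2 ^ 2) ^ 2) (by fun_prop)
    rw [← this, hv]
    have hx : ∀ q : ℝ × ℝ, (q.1 ^ 2 + q.2 ^ 2) ^ 2 =
        q.1 ^ 4 * q.2 ^ 0 + q.1 ^ 0 * q.2 ^ 4 + 2 * (q.1 ^ 2 * q.2 ^ 2) := by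
      intro q; ring
    simp_rw [hx]
    rw [integral_add ((e _ _).fun_add (e _ _)) ((e _ _).const_mul _), integral_add (e _ _) (e _ _),
      integral_const_mul, integral_prod_mul (fun x : ℝ => x ^ 4) (fun x : ℝ => x ^ 0),
      integral_prod_mul (fun x : ℝ => x ^ 0) (fun x : ℝ => x ^ 4),
      integral_prod_mul (fun x : ℝ => x ^ 2) (fun x : ℝ => x ^ 2),
      integral_sq_gaussianReal, integral_pow_four_gaussianReal]
    simp
    ring
  rw [h2, h4]
  push_cast
  ring

end Isotropic

/-! ### Polarization and Wick's formula -/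

/-- A form of bidegree `(2,2)`, symmetric in both pairs of arguments, is determined by its
values on the diagonal. -/
theorem eq_zero_of_diagonal {V : Type*} [AddCommGroup V] [Module ℂ V] (D : V → V → V → V → ℂ)
    (hadd : ∀ a a' b c d, D (a + a') b c d = D a b c d + D a' b c d)
    (hsmul : ∀ (r : ℂ) a b c d, D (r • a) b c d = r * D a b c d)
    (hadd' : ∀ a b c c' d, D a b (c + c') d = D a b c d + D a b c' d)
    (hsmul' : ∀ (r : ℂ) a b c d, D a b (r • c) d = conj r * D a b c d)
    (hsymm : ∀ a b c d, D a b c d = D b a c d) (hsymm' : ∀ a b c d, D a b c d = D a b d c)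
    (hdiag : ∀ a, D a a a a = 0) (a b c d : V) : D a b c d = 0 := by
  have hadd2 : ∀ a b b' c d, D a (b + b') c d = D a b c d + D a b' c d := fun a b b' c d => by
    rw [hsymm, hadd, hsymm b, hsymm b']
  have hsmul2 : ∀ (r : ℂ) a b c d, D a (r • b) c d = r * D a b c d := fun r a b c d => by
    rw [hsymm, hsmul, hsymm b]
  have hadd3 : ∀ a b c d d', D a b c (d + d') = D a b c d + D a b c d' := fun a b c d d' => by
    rw [hsymm', hadd', hsymm' a b d, hsymm' a b d']
  have hsmul3 : ∀ (r : ℂ) a b c d, D a b c (r • d) = conj r * D a b c d := fun r a b c d => by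
    rw [hsymm', hsmul', hsymm' a b d]
  -- Sum the diagonal values at `x + ζy` over the fourth roots of unity `ζ` with weight `ζ²`: only
  -- the terms whose total power of `ζ` is divisible by four survive.
  have key : ∀ x y, D x x y y + D y y x x = 0 := by
    intro x y
    have e1 := hdiag (x + (1 : ℂ) • y)
    have e2 := hdiag (x + (-1 : ℂ) • y)
    have e3 := hdiag (x + Complex.I • y)
    have e4 := hdiag (x + (-Complex.I) • y)
    simp only [hadd, hadd2, hadd', hadd3, hsmul, hsmul2, hsmul', hsmul3, map_neg, map_one,
      Complex.conj_I] at e1 e2 e3 e4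
    ring_nf at e1 e2 e3 e4
    simp only [Complex.I_sq, Complex.I_pow_three, Complex.I_pow_four] at e1 e2 e3 e4
    linear_combination (1 / 4) * (e1 + e2 - e3 - e4)
  -- Replacing `y` by `(1 + i)y` multiplies the two terms of `key` by `-2i` and `2i`, which
  -- separates them.
  have key2 : ∀ x y, D x x y y = 0 := by
    intro x y
    have e1 := key x y
    have e2 := key x ((1 + Complex.I) • y)
    simp only [hsmul, hsmul2, hsmul', hsmul3, map_add, map_one, Complex.conj_I] at e2
    ring_nf at e2
    simp only [Complex.I_sq] at e2
    ring_nf at e2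
    have hI : Complex.I * Complex.I = -1 := Complex.I_mul_I
    linear_combination (1 / 2) * e1 + (Complex.I / 4) * e2
      + (1 / 2 * D x x y y - 1 / 2 * D y y x x) * hI
  have key3 : ∀ a b y, D a b y y = 0 := by
    intro a b y
    have e := key2 (a + b) y
    simp only [hadd, hadd2, key2] at e
    rw [hsymm b a] at e
    linear_combination (1 / 2) * e
  have e := key3 a b (c + d)
  simp only [hadd', hadd3, key3] at e
  rw [hsymm' a b d c] at e
  linear_combination (1 / 2) * e

instance holderTriple_four_four_two : ENNReal.HolderTriple 4 4 2 where
  inv_add_inv_eq_inv := by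
    rw [← two_mul, show (4 : ENNReal) = 2 * 2 by norm_num,
      ENNReal.mul_inv (by norm_num) (by norm_num), ← mul_assoc,
      ENNReal.mul_inv_cancel (by norm_num) (by norm_num), one_mul]

section Wick

variable {Ω : Type*} [MeasurableSpace Ω] {P : Measure Ω}

theorem memLp_conj {X : Ω → ℂ} {p : ENNReal} (h : MemLp X p P) :
    MemLp (fun ω => conj (X ω)) p P :=
  h.star

theorem memLp_two_mul {X Y : Ω → ℂ} (hX : MemLp X 4 P) (hY : MemLp Y 4 P) :
    MemLp (fun ω => X ω * Y ω) 2 P :=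
  hY.mul hX

theorem integrable_mul_two {X Y : Ω → ℂ} (hX : MemLp X 2 P) (hY : MemLp Y 2 P) :
    Integrable (fun ω => X ω * Y ω) P :=
  hX.integrable_mul hY

theorem integrable_mul_four {A B C D : Ω → ℂ} (hA : MemLp A 4 P) (hB : MemLp B 4 P)
    (hC : MemLp C 4 P) (hD : MemLp D 4 P) :
    Integrable (fun ω => A ω * B ω * conj (C ω) * conj (D ω)) P := by
  simpa only [mul_assoc] using integrable_mul_two (memLp_two_mul hA hB)
    (memLp_two_mul (memLp_conj hC) (memLp_conj hD))

/-- The difference of the two sides is a symmetric form of bidegree `(2,2)` on `W`, zero on the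
diagonal by `integral_normSq_sq`, so polarization applies. Taking `W` a linear space encodes joint
normality: all linear combinations are isotropic. -/
theorem wick_formula (W : Submodule ℂ (Ω → ℂ)) (hW : ∀ X ∈ W, IsIsotropicComplexNormal P X)
    {A B C D : Ω → ℂ} (hA : A ∈ W) (hB : B ∈ W) (hC : C ∈ W) (hD : D ∈ W) :
    ∫ ω, A ω * B ω * conj (C ω) * conj (D ω) ∂P =
      (∫ ω, A ω * conj (C ω) ∂P) * (∫ ω, B ω * conj (D ω) ∂P)
        + (∫ ω, A ω * conj (D ω) ∂P) * (∫ ω, B ω * conj (C ω) ∂P) := by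
  have h4 : ∀ X : W, MemLp (X : Ω → ℂ) 4 P := fun X => by
    simpa using (hW X X.2).memLp 4
  have h2 : ∀ X : W, MemLp (X : Ω → ℂ) 2 P := fun X => by
    simpa using (hW X X.2).memLp 2
  have i4 := fun A B C D : W => integrable_mul_four (h4 A) (h4 B) (h4 C) (h4 D)
  have i2 := fun A B : W => integrable_mul_two (h2 A) (memLp_conj (h2 B))
  have := eq_zero_of_diagonal (V := W) (fun A B C D =>
    ∫ ω, A.1 ω * B.1 ω * conj (C.1 ω) * conj (D.1 ω) ∂P -
      ((∫ ω, A.1 ω * conj (C.1 ω) ∂P) * (∫ ω, B.1 ω * conj (D.1 ω) ∂P)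
        + (∫ ω, A.1 ω * conj (D.1 ω) ∂P) * (∫ ω, B.1 ω * conj (C.1 ω) ∂P)))
    ?_ ?_ ?_ ?_ ?_ ?_ ?_ ⟨A, hA⟩ ⟨B, hB⟩ ⟨C, hC⟩ ⟨D, hD⟩
  · exact sub_eq_zero.1 this
  · intro a a' b c d
    simp only [Submodule.coe_add, Pi.add_apply, add_mul]
    rw [integral_add (i4 _ _ _ _) (i4 _ _ _ _), integral_add (i2 _ _) (i2 _ _),
      integral_add (i2 _ _) (i2 _ _)]
    ring
  · intro r a b c d
    simp only [Submodule.coe_smul, Pi.smul_apply, smul_eq_mul, mul_assoc]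
    simp only [integral_const_mul]
    ring
  · intro a b c c' d
    simp only [Submodule.coe_add, Pi.add_apply, map_add, add_mul, mul_add]
    rw [integral_add (i4 _ _ _ _) (i4 _ _ _ _), integral_add (i2 _ _) (i2 _ _),
      integral_add (i2 _ _) (i2 _ _)]
    ring
  · intro r a b c d
    have e4 : ∀ ω, a.1 ω * b.1 ω * conj ((r • c).1 ω) * conj (d.1 ω) =
        conj r * (a.1 ω * b.1 ω * conj (c.1 ω) * conj (d.1 ω)) := fun ω => by
      simp only [Submodule.coe_smul, Pi.smul_apply, smul_eq_mul, map_mul]; ring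
    have e2 : ∀ (a : W) ω, a.1 ω * conj ((r • c).1 ω) = conj r * (a.1 ω * conj (c.1 ω)) :=
      fun a ω => by
      simp only [Submodule.coe_smul, Pi.smul_apply, smul_eq_mul, map_mul]; ring
    simp only [e4, e2, integral_const_mul]
    ring
  · intro a b c d
    simp only [mul_comm (a.1 _) (b.1 _)]
    ring
  · intro a b c d
    simp only [mul_right_comm _ (conj (c.1 _)) (conj (d.1 _))]
    ring
  · intro a
    simp only [(hW a a.2).integral_normSq_sq]
    ring

end Wick

/-! ### The Fourier multiplier of the semigroup -/

/-- The number `4π²(i+μ)|k|²+1`. -/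
noncomputable def symb (μ : ℝ) (k : Z3) : ℂ := 4 * Real.pi ^ 2 * (Complex.I + μ) * normSq k + 1

/-- The number `4π²μ|k|²+1`, the real part of `symb μ k`. -/
noncomputable def symbRe (μ : ℝ) (k : Z3) : ℝ := 4 * Real.pi ^ 2 * μ * normSq k + 1

theorem symb_eq (μ : ℝ) (k : Z3) :
    symb μ k = (symbRe μ k : ℂ) + (4 * Real.pi ^ 2 * normSq k : ℝ) * Complex.I := by
  simp only [symb, symbRe]; push_cast; ring

theorem symb_re (μ : ℝ) (k : Z3) : (symb μ k).re = symbRe μ k := by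
  rw [symb_eq]
  simp only [Complex.add_re, Complex.ofReal_re, Complex.re_ofReal_mul, Complex.I_re, mul_zero,
    add_zero]

theorem normSq_nonneg (k : Z3) : 0 ≤ normSq k := Finset.sum_nonneg fun _ _ => sq_nonneg _

theorem one_le_symbRe {μ : ℝ} (hμ : 0 < μ) (k : Z3) : 1 ≤ symbRe μ k := by
  have := normSq_nonneg k
  have : 0 ≤ 4 * Real.pi ^ 2 * μ * normSq k := by positivity
  unfold symbRe; linarith

theorem h_eq (μ s : ℝ) (k : Z3) : h μ s k = Complex.exp (-(symb μ k * s)) := rfl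

theorem continuous_h (μ t : ℝ) (k : Z3) : Continuous fun s => h μ (t - s) k := by
  simp only [h_eq]; fun_prop

theorem norm_h (μ s : ℝ) (k : Z3) : ‖h μ s k‖ = Real.exp (-(symbRe μ k * s)) := by
  rw [h_eq, Complex.norm_exp]
  congr 1
  rw [Complex.neg_re, Complex.mul_re, symb_re]
  simp

theorem norm_h_le {μ : ℝ} (hμ : 0 < μ) {s : ℝ} (hs : 0 ≤ s) (k : Z3) :
    ‖h μ s k‖ ≤ Real.exp (-s) := by
  rw [norm_h]
  gcongr
  exact le_mul_of_one_le_left hs (one_le_symbRe hμ k)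

theorem integrableOn_exp_neg_sub (t : ℝ) :
    IntegrableOn (fun s => Real.exp (-(t - s))) (Set.Iic t) := by
  have := (integrableOn_exp_mul_Iic (a := 1) one_pos t).const_mul (Real.exp (-t))
  refine this.congr (ae_of_all _ fun s => ?_)
  simp only [← Real.exp_add]
  congr 1; ring

/-- The exponential integral that produces the denominators of the lattice sums. -/
theorem integral_exp_neg_mul_sub {a : ℂ} (ha : 0 < a.re) (t : ℝ) :
    ∫ s in Set.Iic t, Complex.exp (-(a * (t - s : ℝ))) = 1 / a := by
  have h : ∀ s : ℝ, Complex.exp (-(a * (t - s : ℝ))) =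
      Complex.exp (-(a * t)) * Complex.exp (a * s) := fun s => by
    rw [← Complex.exp_add]; congr 1; push_cast; ring
  simp_rw [h]
  rw [integral_const_mul, integral_exp_mul_complex_Iic ha, mul_div_assoc', ← Complex.exp_add]
  simp

/-! ### Fourier monomials on the torus -/

theorem norm_mFourier_apply (k : Z3) (x : T3) : ‖mFourier k x‖ = 1 := by
  simp only [mFourier, ContinuousMap.coe_mk, norm_prod, fourier_apply]
  exact Finset.prod_eq_one fun i _ => Circle.norm_coe _

theorem integral_mFourier_mul_conj (k l : Z3) :
    ∫ x, mFourier k x * conj (mFourier l x) ∂torusMeasure = if k = l then 1 else 0 := by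
  have := orthonormal_iff_ite.1 (orthonormal_mFourier (d := Fin 3)) l k
  simp only [ContinuousMap.inner_toLp] at this
  simp only [eq_comm (a := l)] at this
  exact this

instance isProbabilityMeasure_torusMeasure : IsProbabilityMeasure torusMeasure := by
  unfold torusMeasure; infer_instance

/-! ### Second and fourth moments of the stochastic convolution -/

/-- The integrand of the stochastic convolution. -/
noncomputable def convKernel (μ : ℝ) (k : Z3) (t : ℝ) (s : ℝ) : ℂ :=
  (Set.Iic t).indicator (fun s => h μ (t - s) k) s

theorem measurable_convKernel (μ : ℝ) (k : Z3) (t : ℝ) : Measurable (convKernel μ k t) :=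
  (continuous_h μ t k).measurable.indicator measurableSet_Iic

/-- Only the noise before the earlier time `s` is shared. There the exponent splits into a
decorrelation factor over `t - s`, carrying the conjugate symbol of the later factor, and a real
decay in `s - r`. -/
theorem convKernel_mul_conj (μ : ℝ) (k : Z3) {s t : ℝ} (hst : s ≤ t) (r : ℝ) :
    convKernel μ k s r * conj (convKernel μ k t r) =
      (Set.Iic s).indicator (fun r => Complex.exp (-(conj (symb μ k) * (t - s : ℝ))) *
        Complex.exp (-((2 * symbRe μ k : ℝ) * (s - r : ℝ)))) r := by
  unfold convKernel
  by_cases hr : r ∈ Set.Iic s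
  · have hr' : r ∈ Set.Iic t := le_trans hr hst
    rw [Set.indicator_of_mem hr, Set.indicator_of_mem hr', Set.indicator_of_mem hr, h_eq, h_eq,
      ← Complex.exp_conj, ← Complex.exp_add, ← Complex.exp_add]
    congr 1
    simp only [symb_eq, map_neg, map_mul, map_add, Complex.conj_ofReal, Complex.conj_I]
    push_cast
    ring
  · simp [Set.indicator_of_notMem hr]

theorem integral_convKernel_mul_conj {μ : ℝ} (hμ : 0 < μ) (k : Z3) {s t : ℝ} (hst : s ≤ t) :
    ∫ r, convKernel μ k s r * conj (convKernel μ k t r) =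
      Complex.exp (-(conj (symb μ k) * (t - s : ℝ))) / (2 * symbRe μ k) := by
  have := one_le_symbRe hμ k
  simp_rw [convKernel_mul_conj μ k hst]
  rw [integral_indicator measurableSet_Iic, integral_const_mul,
    integral_exp_neg_mul_sub (by rw [Complex.ofReal_re]; linarith)]
  push_cast
  ring

theorem memLp_convKernel {μ : ℝ} (hμ : 0 < μ) (k : Z3) (t : ℝ) :
    MemLp (fun p : ℝ × T3 => convKernel μ k t p.1 * mFourier (-k) p.2) 2 spaceTimeMeasure := by
  have hm : Measurable fun p : ℝ × T3 => convKernel μ k t p.1 * mFourier (-k) p.2 :=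
    ((measurable_convKernel μ k t).comp measurable_fst).mul
      ((mFourier (-k)).continuous.measurable.comp measurable_snd)
  rw [memLp_two_iff_integrable_sq_norm hm.aestronglyMeasurable]
  have h1 : Integrable (fun s => ‖convKernel μ k t s‖ ^ 2) := by
    have hi : Integrable ((Set.Iic t).indicator fun s => Real.exp (-(t - s))) :=
      (integrable_indicator_iff measurableSet_Iic).2 (integrableOn_exp_neg_sub t)
    refine hi.mono' (by have := (measurable_convKernel μ k t).norm.pow_const 2
                        exact this.aestronglyMeasurable) (ae_of_all _ fun s => ?_)
    unfold convKernel
    by_cases hs : s ∈ Set.Iic t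
    · have h0 : 0 ≤ t - s := sub_nonneg.2 hs
      rw [Set.indicator_of_mem hs, Set.indicator_of_mem hs, Real.norm_of_nonneg (by positivity)]
      have h2 := norm_h_le hμ h0 k
      have h3 : Real.exp (-(t - s)) ≤ 1 := Real.exp_le_one_iff.2 (by linarith)
      have h4 := norm_nonneg (h μ (t - s) k)
      nlinarith
    · simp [Set.indicator_of_notMem hs]
  have := h1.mul_prod (integrable_const (1 : ℝ) (μ := torusMeasure))
  refine this.congr (ae_of_all _ fun p => ?_)
  simp [norm_mFourier_apply]

section Noise

variable {Ω : Type*} {μ : ℝ}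
  {ξ : (ℝ × T3 → ℂ) → Ω → ℂ} {z : Z3 → ℝ → Ω → ℂ}

/-- The linear span of the noise. -/
def noiseSpan (ξ : (ℝ × T3 → ℂ) → Ω → ℂ) : Submodule ℂ (Ω → ℂ) :=
  Submodule.span ℂ (ξ '' {φ | MemLp φ 2 spaceTimeMeasure})

theorem stochConv_mem_noiseSpan (ξ : (ℝ × T3 → ℂ) → Ω → ℂ) (hμ : 0 < μ) (k : Z3) (t : ℝ) :
    stochConv μ ξ k t ∈ noiseSpan ξ :=
  Submodule.subset_span ⟨_, memLp_convKernel hμ k t, rfl⟩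

variable [MeasurableSpace Ω] {P : Measure Ω}

theorem IsComplexWhiteNoise.isotropic (hξ : IsComplexWhiteNoise P ξ) {X : Ω → ℂ}
    (hX : X ∈ noiseSpan ξ) : IsIsotropicComplexNormal P X := by
  obtain ⟨n, c, g, rfl⟩ := Submodule.mem_span_set'.1 hX
  choose φ hφ hg using fun i => (g i).2
  convert! hξ.jointly_isotropic n φ c hφ using 1
  ext ω
  simp [hg]

theorem integral_stochConv_mul_conj (hξ : IsComplexWhiteNoise P ξ) (hμ : 0 < μ) (k l : Z3)
    {s t : ℝ} (hst : s ≤ t) :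
    ∫ ω, stochConv μ ξ k s ω * conj (stochConv μ ξ l t ω) ∂P =
      if k = l then Complex.exp (-(conj (symb μ k) * (t - s : ℝ))) / (2 * symbRe μ k) else 0 := by
  have h := hξ.covariance _ _ (memLp_convKernel hμ k s) (memLp_convKernel hμ l t)
  -- Both sides of the covariance identity match by unfolding: `stochConv` is the noise tested
  -- against `convKernel` times `e_{-k}`.
  refine h.trans ?_
  have e : ∀ p : ℝ × T3, convKernel μ k s p.1 * mFourier (-k) p.2 *
      conj (convKernel μ l t p.1 * mFourier (-l) p.2) =
      (convKernel μ k s p.1 * conj (convKernel μ l t p.1)) *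
        (mFourier (-k) p.2 * conj (mFourier (-l) p.2)) := fun p => by
    rw [map_mul]; ring
  simp_rw [e]
  rw [spaceTimeMeasure, integral_prod_mul (fun r => convKernel μ k s r * conj (convKernel μ l t r))
    (fun x => mFourier (-k) x * conj (mFourier (-l) x)), integral_mFourier_mul_conj]
  by_cases hkl : k = l
  · subst hkl
    simp [integral_convKernel_mul_conj hμ k hst]
  · simp [hkl]

theorem IsStochConvVersion.memLp (hz : IsStochConvVersion P μ ξ z)
    (hξ : IsComplexWhiteNoise P ξ) (hμ : 0 < μ)
    (k : Z3) (t : ℝ) (p : ℝ≥0) : MemLp (z k t) p P :=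
  ((hξ.isotropic (stochConv_mem_noiseSpan ξ hμ k t)).memLp p).ae_eq (hz.ae_eq k t).symm

theorem IsStochConvVersion.integral_mul_conj (hz : IsStochConvVersion P μ ξ z)
    (hξ : IsComplexWhiteNoise P ξ) (hμ : 0 < μ)
    (k l : Z3) {s t : ℝ} (hst : s ≤ t) :
    ∫ ω, z k s ω * conj (z l t ω) ∂P =
      if k = l then Complex.exp (-(conj (symb μ k) * (t - s : ℝ))) / (2 * symbRe μ k) else 0 := by
  rw [← integral_stochConv_mul_conj hξ hμ k l hst]
  refine integral_congr_ae ?_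
  filter_upwards [hz.ae_eq k s, hz.ae_eq l t] with ω h1 h2
  rw [h1, h2]

theorem IsStochConvVersion.wick (hz : IsStochConvVersion P μ ξ z)
    (hξ : IsComplexWhiteNoise P ξ) (hμ : 0 < μ)
    (a b c d : Z3 × ℝ) :
    ∫ ω, z a.1 a.2 ω * z b.1 b.2 ω * conj (z c.1 c.2 ω) * conj (z d.1 d.2 ω) ∂P =
      (∫ ω, z a.1 a.2 ω * conj (z c.1 c.2 ω) ∂P) * (∫ ω, z b.1 b.2 ω * conj (z d.1 d.2 ω) ∂P)
      + (∫ ω, z a.1 a.2 ω * conj (z d.1 d.2 ω) ∂P) *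
        (∫ ω, z b.1 b.2 ω * conj (z c.1 c.2 ω) ∂P) := by
  have h := fun a : Z3 × ℝ => stochConv_mem_noiseSpan ξ hμ a.1 a.2
  have e2 : ∀ a c : Z3 × ℝ, ∫ ω, z a.1 a.2 ω * conj (z c.1 c.2 ω) ∂P =
      ∫ ω, stochConv μ ξ a.1 a.2 ω * conj (stochConv μ ξ c.1 c.2 ω) ∂P := fun a c => by
    refine integral_congr_ae ?_
    filter_upwards [hz.ae_eq a.1 a.2, hz.ae_eq c.1 c.2] with ω h1 h2
    rw [h1, h2]
  simp only [e2]
  rw [← wick_formula (noiseSpan ξ) (fun X hX => hξ.isotropic hX) (h a) (h b) (h c) (h d)]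
  refine integral_congr_ae ?_
  filter_upwards [hz.ae_eq a.1 a.2, hz.ae_eq b.1 b.2, hz.ae_eq c.1 c.2, hz.ae_eq d.1 d.2]
    with ω h1 h2 h3 h4
  rw [h1, h2, h3, h4]

/-- The exact value is `2 / (2 * symbRe μ k)²`, at most `1/2`. What matters is a bound uniform in
time, which feeds the domination needed for Fubini. -/
theorem IsStochConvVersion.integral_norm_pow_four_le (hz : IsStochConvVersion P μ ξ z)
    (hξ : IsComplexWhiteNoise P ξ) (hμ : 0 < μ)
    (k : Z3) (t : ℝ) :
    ∫ ω, ‖z k t ω‖ ^ 4 ∂P ≤ 1 := by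
  have h := hz.wick hξ hμ (k, t) (k, t) (k, t) (k, t)
  simp only [hz.integral_mul_conj hξ hμ k k le_rfl, if_true] at h
  have e : ∀ ω, z k t ω * z k t ω * conj (z k t ω) * conj (z k t ω) = ((‖z k t ω‖ ^ 4 : ℝ) : ℂ) := by
    intro ω
    have : z k t ω * z k t ω * conj (z k t ω) * conj (z k t ω) = (z k t ω * conj (z k t ω)) ^ 2 := by
      ring
    rw [this, Complex.mul_conj, Complex.normSq_eq_norm_sq]
    push_cast; ring
  simp_rw [e] at h
  rw [integral_complex_ofReal] at h
  have h' : ∫ ω, ‖z k t ω‖ ^ 4 ∂P = 2 * (1 / (2 * symbRe μ k)) ^ 2 := by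
    apply Complex.ofReal_injective
    rw [h]
    push_cast
    simp
    ring
  have h1 := one_le_symbRe hμ k
  have h2 : 1 / (2 * symbRe μ k) ≤ 1 / 2 := by
    rw [div_le_div_iff₀ (by linarith) (by norm_num)]; linarith
  have h3 : 0 ≤ 1 / (2 * symbRe μ k) := by positivity
  rw [h']
  nlinarith

end Noise

/-! ### Trigonometric polynomials -/

section Trig

variable {ι κ : Type*}

theorem mFourierCoeff_sum (A : Finset ι) (c : ι → ℂ) (n : ι → Z3) (k : Z3) :
    mFourierCoeff (fun x => ∑ i ∈ A, c i * mFourier (n i) x) k =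
      ∑ i ∈ A, if k = n i then c i else 0 := by
  have e : ∀ x : T3, mFourier (-k) x • ∑ i ∈ A, c i * mFourier (n i) x =
      ∑ i ∈ A, c i * (mFourier (n i) x * conj (mFourier k x)) := fun x => by
    rw [mFourier_neg, smul_eq_mul, Finset.mul_sum]
    exact Finset.sum_congr rfl fun i _ => by ring
  have hI : ∀ i, Integrable (fun x => c i * (mFourier (n i) x * conj (mFourier k x)))
      torusMeasure := fun i => by
    refine Integrable.of_bound (C := ‖c i‖) ?_ (ae_of_all _ fun x => ?_)
    · exact Continuous.aestronglyMeasurable (by fun_prop)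
    · simp [norm_mFourier_apply]
  have h : mFourierCoeff (fun x => ∑ i ∈ A, c i * mFourier (n i) x) k =
      ∫ x, mFourier (-k) x • ∑ i ∈ A, c i * mFourier (n i) x ∂torusMeasure := rfl
  rw [h]
  simp_rw [e]
  rw [integral_finsetSum _ fun i _ => hI i]
  refine Finset.sum_congr rfl fun i _ => ?_
  rw [integral_const_mul, integral_mFourier_mul_conj]
  simp [eq_comm]

/-- A Fourier multiplier acts diagonally on a trigonometric polynomial. -/
theorem tsum_multiplier (A : Finset ι) (c : ι → ℂ) (n : ι → Z3) (g : Z3 → ℂ) (x : T3) :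
    ∑' k, g k * mFourierCoeff (fun x => ∑ i ∈ A, c i * mFourier (n i) x) k * mFourier k x =
      ∑ i ∈ A, g (n i) * c i * mFourier (n i) x := by
  refine HasSum.tsum_eq ?_
  have h := hasSum_sum (s := A) fun i _ =>
    hasSum_ite_eq (n i) (g (n i) * c i * mFourier (n i) x)
  refine h.congr_fun fun k => ?_
  rw [mFourierCoeff_sum, Finset.mul_sum, Finset.sum_mul]
  refine Finset.sum_congr rfl fun i _ => ?_
  split_ifs with hk
  · rw [hk]
  · simp

theorem heat_sum (μ s : ℝ) (A : Finset ι) (c : ι → ℂ) (n : ι → Z3) (x : T3) :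
    heat μ s (fun x => ∑ i ∈ A, c i * mFourier (n i) x) x =
      ∑ i ∈ A, h μ s (n i) * c i * mFourier (n i) x :=
  tsum_multiplier A c n (h μ s) x

theorem lpBlock_sum (ρ : ℕ → R3 → ℝ) (m : ℕ) (A : Finset ι) (c : ι → ℂ) (n : ι → Z3) (x : T3) :
    lpBlock ρ m (fun x => ∑ i ∈ A, c i * mFourier (n i) x) x =
      ∑ i ∈ A, (ρ m (toR3 (n i)) : ℂ) * c i * mFourier (n i) x :=
  tsum_multiplier A c n (fun k => (ρ m (toR3 k) : ℂ)) x

/-! ### Dyadic partitions of unity and the resonant product -/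

namespace IsDyadicPartition

variable {ρ : ℕ → R3 → ℝ}

/-- The Fourier symbol of the resonant product. -/
noncomputable def resSymb (ρ : ℕ → R3 → ℝ) (k l : Z3) : ℝ :=
  ∑' m : {m : ℕ × ℕ // m.1 ≤ m.2 + 1 ∧ m.2 ≤ m.1 + 1}, ρ m.1.1 (toR3 k) * ρ m.1.2 (toR3 l)

theorem hasSum_mul (hρ : IsDyadicPartition ρ) (y y' : R3) :
    HasSum (fun m : ℕ × ℕ => ρ m.1 y * ρ m.2 y') 1 := by
  have h := Summable.mul_of_nonneg (hρ.sum_eq_one y).summable (hρ.sum_eq_one y').summable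
    (fun m => (hρ.mem_Icc m y).1) (fun m => (hρ.mem_Icc m y').1)
  simpa using (hρ.sum_eq_one y).mul (hρ.sum_eq_one y') h

theorem hasSum_resSymb (hρ : IsDyadicPartition ρ) (k l : Z3) :
    HasSum (fun m : {m : ℕ × ℕ // m.1 ≤ m.2 + 1 ∧ m.2 ≤ m.1 + 1} =>
      ((ρ m.1.1 (toR3 k) * ρ m.1.2 (toR3 l) : ℝ) : ℂ)) (resSymb ρ k l : ℂ) := by
  rw [Complex.hasSum_ofReal]
  exact ((hρ.hasSum_mul (toR3 k) (toR3 l)).summable.subtype _).hasSum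

theorem norm_lt_of_ne_zero (hρ : IsDyadicPartition ρ) {m : ℕ} {y : R3}
    (h : ρ (m + 1) y ≠ 0) : 3 / 4 * 2 ^ m ≤ ‖y‖ ∧ ‖y‖ < 8 / 3 * 2 ^ m := by
  rw [hρ.scaling] at h
  have hy := hρ.support_zero (subset_tsupport _ (Function.mem_support.2 h))
  simp only [Set.mem_sdiff, mem_ball_zero_iff, not_lt, norm_smul, norm_inv, norm_pow,
    Real.norm_ofNat] at hy
  have hp : (0 : ℝ) < 2 ^ m := by positivity
  rw [inv_mul_lt_iff₀ hp, le_inv_mul_iff₀ hp] at hy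
  constructor <;> linarith [hy.1, hy.2]

/-- Blocks two or more apart have disjoint supports, because `8/3 < 3/4 · 2²` for two annuli and
`4/3 < 3/4 · 2` for the central ball. -/
theorem le_succ_of_ne_zero (hρ : IsDyadicPartition ρ) {m m' : ℕ} {y : R3}
    (h : ρ m y ≠ 0) (h' : ρ m' y ≠ 0) : m ≤ m' + 1 := by
  by_contra! hlt
  obtain ⟨a, rfl⟩ : ∃ a, m = a + 1 := ⟨m - 1, by omega⟩
  have h1 := (hρ.norm_lt_of_ne_zero h).1
  cases m' with
  | zero =>
    have hy := hρ.support_neg_one (subset_tsupport _ (Function.mem_support.2 h'))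
    rw [mem_ball_zero_iff] at hy
    have : (2 : ℝ) ^ 1 ≤ 2 ^ a := pow_le_pow_right₀ (by norm_num) (by omega)
    linarith
  | succ b =>
    have h2 := (hρ.norm_lt_of_ne_zero h').2
    have : (2 : ℝ) ^ (b + 2) ≤ 2 ^ a := pow_le_pow_right₀ (by norm_num) (by omega)
    have hp : (0 : ℝ) < 2 ^ b := by positivity
    rw [pow_add] at this
    linarith

theorem toR3_neg (k : Z3) : toR3 (-k) = -toR3 k := by
  ext i; simp [toR3]

/-- Radiality replaces `-k` by `k`, and the restriction `|m - m'| ≤ 1` discards only zero terms. The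
sum is thus the full square `(∑ ρ_m(k))² = 1`. -/
theorem resSymb_neg (hρ : IsDyadicPartition ρ) (k : Z3) :
    resSymb ρ k (-k) = 1 := by
  have hk : ∀ m, ρ m (toR3 (-k)) = ρ m (toR3 k) := fun m =>
    hρ.radial m _ _ (by rw [toR3_neg, norm_neg])
  simp only [resSymb, hk]
  have h := hρ.hasSum_mul (toR3 k) (toR3 k)
  rw [← hasSum_subtype_iff_of_support_subset
    (s := {m : ℕ × ℕ | m.1 ≤ m.2 + 1 ∧ m.2 ≤ m.1 + 1})] at h
  · exact h.tsum_eq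
  · intro m hm
    have hm' := mul_ne_zero_iff.1 (Function.mem_support.1 hm)
    exact ⟨hρ.le_succ_of_ne_zero hm'.1 hm'.2, hρ.le_succ_of_ne_zero hm'.2 hm'.1⟩

theorem resonant_sum (hρ : IsDyadicPartition ρ) (A : Finset ι) (c : ι → ℂ)
    (n : ι → Z3) (B : Finset κ) (d : κ → ℂ) (p : κ → Z3) (x : T3) :
    resonant ρ (fun x => ∑ i ∈ A, c i * mFourier (n i) x)
        (fun x => ∑ j ∈ B, d j * mFourier (p j) x) x =
      ∑ i ∈ A, ∑ j ∈ B, resSymb ρ (n i) (p j) * mFourier (n i + p j) x * (c i * d j) := by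
  refine HasSum.tsum_eq ?_
  have h := hasSum_sum (s := A) fun i _ => hasSum_sum (s := B) fun j _ =>
    ((hρ.hasSum_resSymb (n i) (p j)).mul_right (mFourier (n i + p j) x)).mul_right (c i * d j)
  refine h.congr_fun fun m => ?_
  rw [lpBlock_sum, lpBlock_sum, Finset.sum_mul_sum]
  refine Finset.sum_congr rfl fun i _ => Finset.sum_congr rfl fun j _ => ?_
  rw [mFourier_add]
  push_cast
  ring

end IsDyadicPartition

end Trig

/-! ### Expectation of the resonant product with a Duhamel integral -/

section Expectation

variable {Ω : Type*} [MeasurableSpace Ω] {P : Measure Ω} [IsProbabilityMeasure P]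

/-- Joint integrability on `(-∞, t] × Ω`, as Fubini requires: `h` supplies the factor `e^{-(t-s)}`,
and `|ab| ≤ (|a|² + |b|²)/2` bounds the expectation uniformly in `s`. -/
theorem integrable_prod_h_mul {μ : ℝ} (hμ : 0 < μ) (t : ℝ) (k : Z3) {a : ℝ → Ω → ℂ} {b : Ω → ℂ}
    (ham : Measurable fun q : ℝ × Ω => a q.1 q.2) (ha : ∀ s, MemLp (a s) 2 P) {C : ℝ}
    (hC : ∀ s, ∫ ω, ‖a s ω‖ ^ 2 ∂P ≤ C) (hb : MemLp b 2 P) :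
    Integrable (fun q : ℝ × Ω => h μ (t - q.1) k * (a q.1 q.2 * b q.2))
      ((volume.restrict (Set.Iic t)).prod P) := by
  have hm : AEStronglyMeasurable (fun q : ℝ × Ω => h μ (t - q.1) k * (a q.1 q.2 * b q.2))
      ((volume.restrict (Set.Iic t)).prod P) :=
    ((continuous_h μ t k).measurable.comp measurable_fst).aestronglyMeasurable.mul
      (ham.aestronglyMeasurable.mul hb.aestronglyMeasurable.comp_snd)
  refine (integrable_prod_iff hm).2 ⟨ae_of_all _ fun s =>
    (integrable_mul_two (ha s) hb).const_mul (h μ (t - s) k), ?_⟩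
  refine ((integrableOn_exp_neg_sub t).mul_const ((C + ∫ ω, ‖b ω‖ ^ 2 ∂P) / 2)).mono'
    hm.norm.integral_prod_right' ?_
  refine (ae_restrict_iff' measurableSet_Iic).2 (ae_of_all _ fun s hs => ?_)
  have h0 : 0 ≤ t - s := sub_nonneg.2 hs
  have ia := (memLp_two_iff_integrable_sq_norm (ha s).aestronglyMeasurable).1 (ha s)
  have ib := (memLp_two_iff_integrable_sq_norm hb.aestronglyMeasurable).1 hb
  rw [Real.norm_of_nonneg (integral_nonneg fun _ => norm_nonneg _)]
  simp only [norm_mul (h μ (t - s) k)]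
  rw [integral_const_mul]
  refine mul_le_mul (norm_h_le hμ h0 k) ?_ (integral_nonneg fun _ => norm_nonneg _)
    (Real.exp_pos _).le
  calc ∫ ω, ‖a s ω * b ω‖ ∂P ≤ ∫ ω, (‖a s ω‖ ^ 2 + ‖b ω‖ ^ 2) / 2 ∂P := by
        refine integral_mono (integrable_mul_two (ha s) hb).norm ((ia.add ib).div_const 2)
          fun ω => ?_
        simp only [norm_mul]
        nlinarith [sq_nonneg (‖a s ω‖ - ‖b ω‖)]
    _ = ((∫ ω, ‖a s ω‖ ^ 2 ∂P) + ∫ ω, ‖b ω‖ ^ 2 ∂P) / 2 := by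
        rw [integral_div, integral_add ia ib]
    _ ≤ _ := by linarith [hC s]

/-- This is where `ρ` and `x` drop out. Pairs of non-opposite frequencies have zero expectation by
`horth`; for opposite ones both the resonant symbol and the exponential equal `1`. -/
theorem integral_resonant_duhamel {ι κ : Type*} {ρ : ℕ → R3 → ℝ} (hρ : IsDyadicPartition ρ)
    {μ : ℝ} (hμ : 0 < μ) (t : ℝ) (x : T3) (A : Finset ι) (B : Finset κ) (n : ι → Z3) (p : κ → Z3)
    {a : ι → ℝ → Ω → ℂ} {b : κ → Ω → ℂ}
    (ham : ∀ i, Measurable fun q : ℝ × Ω => a i q.1 q.2) (ha : ∀ i s, MemLp (a i s) 2 P)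
    {C : ι → ℝ} (hC : ∀ i s, ∫ ω, ‖a i s ω‖ ^ 2 ∂P ≤ C i) (hb : ∀ j, MemLp (b j) 2 P)
    (horth : ∀ i j, ∀ s ≤ t, p j ≠ -n i → ∫ ω, a i s ω * b j ω ∂P = 0)
    {F : Ω → ℝ → T3 → ℂ} (hF : ∀ ω s x, F ω s x = ∑ i ∈ A, a i s ω * mFourier (n i) x)
    {G : Ω → T3 → ℂ} (hG : ∀ ω x, G ω x = ∑ j ∈ B, b j ω * mFourier (p j) x) :
    Integrable (fun ω => resonant ρ (duhamel μ (F ω) t) (G ω) x) P ∧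
    ∫ ω, resonant ρ (duhamel μ (F ω) t) (G ω) x ∂P =
      ∑ i ∈ A, ∑ j ∈ B, ∫ s in Set.Iic t, h μ (t - s) (n i) * ∫ ω, a i s ω * b j ω ∂P := by
  set U : ι → Ω → ℂ := fun i ω => ∫ s in Set.Iic t, h μ (t - s) (n i) * a i s ω with hU
  have hint := fun i j => integrable_prod_h_mul (P := P) hμ t (n i) (ham i) (ha i) (hC i) (hb j)
  have hUb : ∀ i j ω, U i ω * b j ω =
      ∫ s in Set.Iic t, h μ (t - s) (n i) * (a i s ω * b j ω) := fun i j ω => by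
    simp only [← mul_assoc]
    rw [integral_mul_const]
  have hUi : ∀ i j, Integrable (fun ω => U i ω * b j ω) P := fun i j => by
    simp only [hUb]
    exact (hint i j).integral_prod_right
  have hUe : ∀ i j, ∫ ω, U i ω * b j ω ∂P =
      ∫ s in Set.Iic t, h μ (t - s) (n i) * ∫ ω, a i s ω * b j ω ∂P := fun i j => by
    simp only [hUb]
    rw [← integral_integral_swap (f := fun s ω => h μ (t - s) (n i) * (a i s ω * b j ω))
      (hint i j)]
    simp only [integral_const_mul]
  have hae : ∀ᵐ ω ∂P, resonant ρ (duhamel μ (F ω) t) (G ω) x =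
      ∑ i ∈ A, ∑ j ∈ B, IsDyadicPartition.resSymb ρ (n i) (p j) * mFourier (n i + p j) x *
        (U i ω * b j ω) := by
    have h1 : ∀ᵐ ω ∂P, ∀ i ∈ A,
        Integrable (fun s => h μ (t - s) (n i) * a i s ω) (volume.restrict (Set.Iic t)) := by
      refine (ae_ball_iff A.countable_toSet).2 fun i _ => ?_
      -- The case `b = 1` of joint integrability makes almost every path integrable in time, so the
      -- Duhamel integral can be exchanged with the finite sum.
      have := (integrable_prod_h_mul (P := P) hμ t (n i) (ham i) (ha i) (hC i)
        (memLp_const (1 : ℂ))).prod_left_ae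
      simpa using this
    filter_upwards [h1] with ω hω
    have hd : duhamel μ (F ω) t = fun x => ∑ i ∈ A, U i ω * mFourier (n i) x := by
      funext y
      simp only [duhamel]
      have hFω : ∀ s, F ω s = fun x => ∑ i ∈ A, a i s ω * mFourier (n i) x := fun s =>
        funext (hF ω s)
      simp only [hFω, heat_sum]
      rw [integral_finsetSum _ fun i hi => (hω i hi).mul_const _]
      simp only [integral_mul_const, hU]
    rw [hd, show G ω = _ from funext (hG ω), hρ.resonant_sum]
  refine ⟨Integrable.congr ?_ (hae.mono fun _ h => h.symm), ?_⟩
  · exact integrable_finsetSum _ fun i _ => integrable_finsetSum _ fun j _ =>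
      (hUi i j).const_mul _
  rw [integral_congr_ae hae, integral_finsetSum _ fun i _ => integrable_finsetSum _ fun j _ =>
    (hUi i j).const_mul _]
  refine Finset.sum_congr rfl fun i _ => ?_
  rw [integral_finsetSum _ fun j _ => (hUi i j).const_mul _]
  refine Finset.sum_congr rfl fun j _ => ?_
  rw [integral_const_mul, hUe]
  by_cases hp : p j = -n i
  · simp [hp, hρ.resSymb_neg, mFourier_zero]
  · have : ∫ s in Set.Iic t, h μ (t - s) (n i) * ∫ ω, a i s ω * b j ω ∂P = 0 := by
      rw [setIntegral_congr_fun (g := fun _ => 0) measurableSet_Iic fun s hs => by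
        simp only [horth i j s hs hp, mul_zero]]
      simp
    rw [this, mul_zero]

end Expectation

/-! ### The regularized process as a trigonometric polynomial -/

theorem exists_finset_chiEps_eq_zero {χ : R3 → ℝ} (hχ : IsCutoff χ) {ε : ℝ} (hε : 0 < ε) :
    ∃ S : Finset Z3, ∀ k ∉ S, chiEps χ ε k = 0 := by
  obtain ⟨N, hN⟩ := exists_nat_gt ε⁻¹
  refine ⟨Fintype.piFinset fun _ => Finset.Icc (-(N : ℤ)) N, fun k hk => ?_⟩
  by_contra hne
  refine hk (Fintype.mem_piFinset.2 fun i => ?_)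
  have h1 := hχ.support (subset_tsupport _ (Function.mem_support.2 hne))
  rw [mem_ball_zero_iff, norm_smul, Real.norm_of_nonneg hε.le] at h1
  have h2 : ‖toR3 k‖ < ε⁻¹ := by rwa [← one_div, lt_div_iff₀' hε]
  have h3 : ‖toR3 k i‖ ≤ ‖toR3 k‖ := PiLp.norm_apply_le _ i
  have h4 : |(k i : ℝ)| < N := by
    simpa [toR3] using (h3.trans_lt h2).trans hN
  have h5 : |k i| < (N : ℤ) := by exact_mod_cast h4
  rw [Finset.mem_Icc]
  exact abs_le.1 h5.le

section Drivers

variable {Ω : Type*} {χ : R3 → ℝ} {ε : ℝ} {z : Z3 → ℝ → Ω → ℂ} {S : Finset Z3}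

theorem XA_eq_sum (hS : ∀ k ∉ S, chiEps χ ε k = 0) (ω : Ω) (t : ℝ) (x : T3) :
    XA χ ε z ω t x = ∑ k ∈ S, (chiEps χ ε k : ℂ) * z k t ω * mFourier k x :=
  tsum_eq_sum fun k hk => by simp [hS k hk]

theorem XAA_eq_sum (hS : ∀ k ∉ S, chiEps χ ε k = 0) (ω : Ω) (t : ℝ) (x : T3) :
    XAA χ ε z ω t x = ∑ k ∈ S ×ˢ S, ((chiEps χ ε k.1 * chiEps χ ε k.2 : ℝ) : ℂ) *
      (z k.1 t ω * z k.2 t ω) * mFourier (k.1 + k.2) x := by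
  rw [XAA, XA_eq_sum hS, sq, Finset.sum_mul_sum, ← Finset.sum_product']
  refine Finset.sum_congr rfl fun k _ => ?_
  rw [mFourier_add]; push_cast; ring

theorem XA_mul_XB_eq_sum (hS : ∀ k ∉ S, chiEps χ ε k = 0) (ω : Ω) (t : ℝ) (x : T3) :
    XA χ ε z ω t x * XB χ ε z ω t x =
      ∑ k ∈ S ×ˢ S, ((chiEps χ ε k.1 * chiEps χ ε k.2 : ℝ) : ℂ) *
        (z k.1 t ω * conj (z k.2 t ω)) * mFourier (k.1 - k.2) x := by
  rw [XB, XA_eq_sum hS, map_sum, Finset.sum_mul_sum, ← Finset.sum_product']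
  refine Finset.sum_congr rfl fun k _ => ?_
  rw [sub_eq_add_neg, mFourier_add, mFourier_neg]
  simp only [map_mul, Complex.conj_ofReal]
  push_cast; ring

theorem XBB_eq_sum (hS : ∀ k ∉ S, chiEps χ ε k = 0) (ω : Ω) (t : ℝ) (x : T3) :
    XBB χ ε z ω t x = ∑ k ∈ S ×ˢ S, ((chiEps χ ε k.1 * chiEps χ ε k.2 : ℝ) : ℂ) *
      (conj (z k.1 t ω) * conj (z k.2 t ω)) * mFourier (-(k.1 + k.2)) x := by
  rw [XBB, XB, ← map_pow, ← XAA, XAA_eq_sum hS, map_sum]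
  refine Finset.sum_congr rfl fun k _ => ?_
  rw [mFourier_neg]
  simp only [map_mul, Complex.conj_ofReal]

/-- The variance of the `k`-th mode, if `k = l`, and zero otherwise. -/
noncomputable def modeCov (μ : ℝ) (k l : Z3) : ℂ := if k = l then 1 / (2 * symbRe μ k) else 0

variable [MeasurableSpace Ω] {P : Measure Ω} {μ : ℝ} {ξ : (ℝ × T3 → ℂ) → Ω → ℂ}

namespace IsStochConvVersion

theorem integral_mul_conj_self (hz : IsStochConvVersion P μ ξ z) (hξ : IsComplexWhiteNoise P ξ)
    (hμ : 0 < μ) (k l : Z3) (t : ℝ) : ∫ ω, z k t ω * conj (z l t ω) ∂P = modeCov μ k l := by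
  rw [hz.integral_mul_conj hξ hμ k l le_rfl]
  simp [modeCov]

/-- The two Wick pairings correspond to `l = k` and `l = k.swap` and carry the same value. When `k.1
= k.2` both indicators are `1`, so no separate diagonal case arises. -/
theorem integral_mul_mul_conj_mul_conj (hz : IsStochConvVersion P μ ξ z)
    (hξ : IsComplexWhiteNoise P ξ) (hμ : 0 < μ) (k l : Z3 × Z3) {s t : ℝ} (hst : s ≤ t) :
    ∫ ω, (z k.1 s ω * z k.2 s ω) * (conj (z l.1 t ω) * conj (z l.2 t ω)) ∂P =
      ((if l = k then 1 else 0) + (if l = k.swap then 1 else 0)) *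
        (1 / (4 * symbRe μ k.1 * symbRe μ k.2) *
          Complex.exp (-((conj (symb μ k.1) + conj (symb μ k.2)) * (t - s : ℝ)))) := by
  have h := hz.wick hξ hμ (k.1, s) (k.2, s) (l.1, t) (l.2, t)
  simp only [hz.integral_mul_conj hξ hμ _ _ hst] at h
  simp only [← mul_assoc]
  rw [h]
  have e : Complex.exp (-((conj (symb μ k.1) + conj (symb μ k.2)) * (t - s : ℝ))) =
      Complex.exp (-(conj (symb μ k.1) * (t - s : ℝ))) *
        Complex.exp (-(conj (symb μ k.2) * (t - s : ℝ))) := by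
    rw [← Complex.exp_add]; congr 1; ring
  rw [e]
  have h1 : (if k.1 = l.1 then (1 : ℂ) else 0) * (if k.2 = l.2 then 1 else 0) =
      if l = k then 1 else 0 := by
    have : l = k ↔ k.1 = l.1 ∧ k.2 = l.2 := by
      rw [Prod.ext_iff, eq_comm, eq_comm (a := k.2)]
    simp only [this, ite_and]
    split_ifs <;> simp
  have h2 : (if k.1 = l.2 then (1 : ℂ) else 0) * (if k.2 = l.1 then 1 else 0) =
      if l = k.swap then 1 else 0 := by
    have : l = k.swap ↔ k.1 = l.2 ∧ k.2 = l.1 := by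
      rw [Prod.ext_iff, and_comm, Prod.snd_swap, Prod.fst_swap, eq_comm, eq_comm (a := k.2)]
    simp only [this, ite_and]
    split_ifs <;> simp
  have h3 : ∀ (p : Prop) [Decidable p] (c : ℂ), (if p then c else 0) = (if p then 1 else 0) * c :=
    fun p _ c => by split_ifs <;> simp
  rw [← h1, ← h2, h3 (k.1 = l.1), h3 (k.2 = l.2), h3 (k.1 = l.2), h3 (k.2 = l.1)]
  have r1 := one_le_symbRe hμ k.1
  have r2 := one_le_symbRe hμ k.2
  have r1' : (symbRe μ k.1 : ℂ) ≠ 0 := by exact_mod_cast (by linarith : symbRe μ k.1 ≠ 0)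
  have r2' : (symbRe μ k.2 : ℂ) ≠ 0 := by exact_mod_cast (by linarith : symbRe μ k.2 ≠ 0)
  field_simp
  ring

theorem memLp_four (hz : IsStochConvVersion P μ ξ z) (hξ : IsComplexWhiteNoise P ξ)
    (hμ : 0 < μ) (k : Z3) (t : ℝ) : MemLp (z k t) 4 P := by
  simpa using hz.memLp hξ hμ k t 4

theorem memLp_mul (hz : IsStochConvVersion P μ ξ z) (hξ : IsComplexWhiteNoise P ξ)
    (hμ : 0 < μ) (k l : Z3) (t : ℝ) : MemLp (fun ω => z k t ω * z l t ω) 2 P :=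
  memLp_two_mul (hz.memLp_four hξ hμ k t) (hz.memLp_four hξ hμ l t)

theorem memLp_mul_conj (hz : IsStochConvVersion P μ ξ z) (hξ : IsComplexWhiteNoise P ξ)
    (hμ : 0 < μ) (k l : Z3) (t : ℝ) : MemLp (fun ω => z k t ω * conj (z l t ω)) 2 P :=
  memLp_two_mul (hz.memLp_four hξ hμ k t) (memLp_conj (hz.memLp_four hξ hμ l t))

theorem integrable_sq_mul_sq (hz : IsStochConvVersion P μ ξ z) (hξ : IsComplexWhiteNoise P ξ)
    (hμ : 0 < μ) (k l : Z3) (t : ℝ) : Integrable (fun ω => ‖z k t ω‖ ^ 2 * ‖z l t ω‖ ^ 2) P := by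
  have h := hz.memLp_mul hξ hμ k l t
  have := (memLp_two_iff_integrable_sq_norm h.aestronglyMeasurable).1 h
  simpa only [norm_mul, mul_pow] using this

theorem integral_sq_mul_sq_le (hz : IsStochConvVersion P μ ξ z) (hξ : IsComplexWhiteNoise P ξ)
    (hμ : 0 < μ) (k l : Z3) (t : ℝ) : ∫ ω, ‖z k t ω‖ ^ 2 * ‖z l t ω‖ ^ 2 ∂P ≤ 1 := by
  have hi : ∀ k, Integrable (fun ω => ‖z k t ω‖ ^ 4) P := fun k =>
    MemLp.integrable_norm_pow (p := 4) (by exact_mod_cast hz.memLp_four hξ hμ k t) (by norm_num)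
  calc ∫ ω, ‖z k t ω‖ ^ 2 * ‖z l t ω‖ ^ 2 ∂P
      ≤ ∫ ω, (‖z k t ω‖ ^ 4 + ‖z l t ω‖ ^ 4) / 2 ∂P := by
        refine integral_mono (hz.integrable_sq_mul_sq hξ hμ k l t)
          (((hi k).add (hi l)).div_const 2) fun ω => ?_
        simp only
        nlinarith [sq_nonneg (‖z k t ω‖ ^ 2 - ‖z l t ω‖ ^ 2)]
    _ = ((∫ ω, ‖z k t ω‖ ^ 4 ∂P) + ∫ ω, ‖z l t ω‖ ^ 4 ∂P) / 2 := by
        rw [integral_div, integral_add (hi k) (hi l)]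
    _ ≤ 1 := by
        linarith [hz.integral_norm_pow_four_le hξ hμ k t, hz.integral_norm_pow_four_le hξ hμ l t]

variable [IsProbabilityMeasure P]

/-! ### The constant `c₁` -/

theorem integrable_XA_mul_XB (hz : IsStochConvVersion P μ ξ z) (hξ : IsComplexWhiteNoise P ξ)
    (hμ : 0 < μ) (hS : ∀ k ∉ S, chiEps χ ε k = 0) (t : ℝ) (x : T3) :
    Integrable (fun ω => XA χ ε z ω t x * XB χ ε z ω t x) P := by
  simp only [XA_mul_XB_eq_sum hS]
  exact integrable_finsetSum _ fun k _ =>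
    (((hz.memLp_mul_conj hξ hμ _ _ t).integrable one_le_two).const_mul _).mul_const _

/-- The double sum, off-diagonal zeros included, matches the expansion of `Z^ε conj(Z^ε)`, so that
subtracting `c₁` centres each coefficient separately. -/
theorem c1_eq_sum_modeCov (hz : IsStochConvVersion P μ ξ z) (hξ : IsComplexWhiteNoise P ξ)
    (hμ : 0 < μ) (hS : ∀ k ∉ S, chiEps χ ε k = 0) (t : ℝ) (x : T3) :
    c1 P χ ε z t x = ∑ k ∈ S ×ˢ S, ((chiEps χ ε k.1 * chiEps χ ε k.2 : ℝ) : ℂ) *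
      modeCov μ k.1 k.2 * mFourier (k.1 - k.2) x := by
  simp only [c1, XA_mul_XB_eq_sum hS]
  rw [integral_finsetSum _ fun k _ =>
    (((hz.memLp_mul_conj hξ hμ _ _ t).integrable one_le_two).const_mul _).mul_const _]
  refine Finset.sum_congr rfl fun k _ => ?_
  rw [integral_mul_const, integral_const_mul, hz.integral_mul_conj_self hξ hμ]

theorem c1_eq (hz : IsStochConvVersion P μ ξ z) (hξ : IsComplexWhiteNoise P ξ)
    (hμ : 0 < μ) (hS : ∀ k ∉ S, chiEps χ ε k = 0) (t : ℝ) (x : T3) :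
    c1 P χ ε z t x = ∑ k ∈ S, (chiEps χ ε k : ℂ) ^ 2 / (2 * symbRe μ k) := by
  rw [hz.c1_eq_sum_modeCov hξ hμ hS, Finset.sum_product]
  refine Finset.sum_congr rfl fun k hk => ?_
  rw [Finset.sum_eq_single_of_mem k hk fun l _ hl => by simp [modeCov, hl.symm]]
  simp [modeCov, mFourier_zero]
  ring

theorem XAB_eq_sum (hz : IsStochConvVersion P μ ξ z) (hξ : IsComplexWhiteNoise P ξ)
    (hμ : 0 < μ) (hS : ∀ k ∉ S, chiEps χ ε k = 0) (ω : Ω) (t : ℝ) (x : T3) :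
    XAB P χ ε z ω t x = ∑ k ∈ S ×ˢ S, ((chiEps χ ε k.1 * chiEps χ ε k.2 : ℝ) : ℂ) *
      (z k.1 t ω * conj (z k.2 t ω) - modeCov μ k.1 k.2) * mFourier (k.1 - k.2) x := by
  rw [XAB, XA_mul_XB_eq_sum hS, hz.c1_eq_sum_modeCov hξ hμ hS, ← Finset.sum_sub_distrib]
  exact Finset.sum_congr rfl fun k _ => by ring

end IsStochConvVersion

/-! ### Time integration and the denominators of the lattice sums. -/

theorem integral_h_mul_exp {μ : ℝ} (hμ : 0 < μ) (k : Z3) {a : ℂ} (ha : 0 < a.re) (c : ℂ) (t : ℝ) :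
    ∫ s in Set.Iic t, h μ (t - s) k * (c * Complex.exp (-(a * (t - s : ℝ)))) =
      c / (symb μ k + a) := by
  have e : ∀ s : ℝ, h μ (t - s) k * (c * Complex.exp (-(a * (t - s : ℝ)))) =
      c * Complex.exp (-((symb μ k + a) * (t - s : ℝ))) := fun s => by
    rw [h_eq, mul_left_comm, ← Complex.exp_add]; congr 2; ring
  simp_rw [e]
  rw [integral_const_mul, integral_exp_neg_mul_sub, mul_one_div]
  rw [Complex.add_re, symb_re]
  linarith [one_le_symbRe hμ k]

/-- The denominator is the heat symbol at the output frequency plus the decorrelation rates of the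
two contracted modes. -/
theorem symb_add_eq_α₁_β₁ (μ : ℝ) (k l : Z3) :
    symb μ (k + l) + (conj (symb μ k) + conj (symb μ l)) = α₁ μ k l + Complex.I * β₁ k l := by
  simp only [symb_eq, symbRe, α₁, β₁, map_add, map_mul, Complex.conj_ofReal, Complex.conj_I]
  push_cast
  ring

theorem symb_add_eq_α₂_β₂ (μ : ℝ) (k l : Z3) :
    symb μ (k - l) + (conj (symb μ k) + symb μ l) = α₂ μ k l + Complex.I * β₂ k l := by
  simp only [symb_eq, symbRe, α₂, β₂, map_add, map_mul, Complex.conj_ofReal, Complex.conj_I]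
  push_cast
  ring

namespace IsStochConvVersion

variable [IsProbabilityMeasure P]

/-! ### The constant `c₂₁` -/

theorem resIAABB_expectation (hz : IsStochConvVersion P μ ξ z) (hξ : IsComplexWhiteNoise P ξ)
    (hμ : 0 < μ) (hS : ∀ k ∉ S, chiEps χ ε k = 0) {ρ : ℕ → R3 → ℝ} (hρ : IsDyadicPartition ρ)
    (t : ℝ) (x : T3) :
    Integrable (resIAABB μ χ ε z ρ t x) P ∧
    c21 P μ χ ε z ρ t x = ∑ k ∈ S ×ˢ S, ((chiEps χ ε k.1 : ℂ) * chiEps χ ε k.2) ^ 2 /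
      (4 * symbRe μ k.1 * symbRe μ k.2 * (α₁ μ k.1 k.2 + Complex.I * β₁ k.1 k.2)) := by
  set w : Z3 × Z3 → ℝ := fun k => chiEps χ ε k.1 * chiEps χ ε k.2 with hw
  have hE : ∀ k l : Z3 × Z3, ∀ s ≤ t,
      ∫ ω, (w k * (z k.1 s ω * z k.2 s ω)) * (w l * (conj (z l.1 t ω) * conj (z l.2 t ω))) ∂P =
        ((w k : ℂ) * w l * ((if l = k then 1 else 0) + (if l = k.swap then 1 else 0)) *
          (1 / (4 * symbRe μ k.1 * symbRe μ k.2))) *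
          Complex.exp (-((conj (symb μ k.1) + conj (symb μ k.2)) * (t - s : ℝ))) := by
    intro k l s hs
    simp only [mul_mul_mul_comm (w k : ℂ) _ (w l : ℂ) _]
    rw [integral_const_mul, hz.integral_mul_mul_conj_mul_conj hξ hμ k l hs]
    ring
  have key := integral_resonant_duhamel (P := P) hρ hμ t x (S ×ˢ S) (S ×ˢ S)
    (fun k => k.1 + k.2) (fun k => -(k.1 + k.2))
    (a := fun k s ω => w k * (z k.1 s ω * z k.2 s ω))
    (b := fun l ω => w l * (conj (z l.1 t ω) * conj (z l.2 t ω)))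
    (C := fun k => ‖(w k : ℂ)‖ ^ 2)
    (fun k => measurable_const.mul ((hz.measurable k.1).mul (hz.measurable k.2)))
    (fun k s => (hz.memLp_mul hξ hμ k.1 k.2 s).const_mul _)
    (fun k s => by
      simp only [norm_mul, mul_pow]
      rw [integral_const_mul]
      exact mul_le_of_le_one_right (by positivity) (hz.integral_sq_mul_sq_le hξ hμ k.1 k.2 s))
    (fun l => (memLp_two_mul (memLp_conj (hz.memLp_four hξ hμ l.1 t))
      (memLp_conj (hz.memLp_four hξ hμ l.2 t))).const_mul _)
    -- Either surviving pairing, `l = k` or `l = k.swap`, would make the output frequencies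
    -- opposite.
    (fun k l s hs hp => by
      rw [hE k l s hs]
      have h1 : l ≠ k := by rintro rfl; exact hp rfl
      have h2 : l ≠ k.swap := by rintro rfl; exact hp (by simp [add_comm])
      simp [h1, h2])
    (F := XAA χ ε z) (fun ω s x => XAA_eq_sum hS ω s x)
    (G := fun ω => XBB χ ε z ω t) (fun ω x => XBB_eq_sum hS ω t x)
  refine ⟨key.1, ?_⟩
  change (1 / 2) * ∫ ω, resonant ρ (duhamel μ (XAA χ ε z ω) t) (XBB χ ε z ω t) x ∂P = _
  rw [key.2, Finset.mul_sum]
  refine Finset.sum_congr rfl fun k hk => ?_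
  -- The denominator is kept opaque so that the final normalization does not expand it.
  obtain ⟨d, hd⟩ : ∃ d : ℂ, α₁ μ k.1 k.2 + Complex.I * β₁ k.1 k.2 = d := ⟨_, rfl⟩
  rw [hd]
  have hk' : k.swap ∈ S ×ˢ S := by
    rw [Finset.mem_product] at hk ⊢; exact ⟨hk.2, hk.1⟩
  have hpos : 0 < (conj (symb μ k.1) + conj (symb μ k.2)).re := by
    rw [Complex.add_re, Complex.conj_re, Complex.conj_re, symb_re, symb_re]
    linarith [one_le_symbRe hμ k.1, one_le_symbRe hμ k.2]
  have hint : ∀ l, ∫ s in Set.Iic t, h μ (t - s) (k.1 + k.2) *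
      ∫ ω, (w k * (z k.1 s ω * z k.2 s ω)) * (w l * (conj (z l.1 t ω) * conj (z l.2 t ω))) ∂P =
        ((w k : ℂ) * w l * ((if l = k then 1 else 0) + (if l = k.swap then 1 else 0)) *
          (1 / (4 * symbRe μ k.1 * symbRe μ k.2))) / d := by
    intro l
    refine (setIntegral_congr_fun measurableSet_Iic fun s hs =>
      congrArg (h μ (t - s) _ * ·) (hE k l s hs)).trans ?_
    rw [integral_h_mul_exp hμ _ hpos, symb_add_eq_α₁_β₁, hd]
  simp only [hint]
  rw [← Finset.sum_div, ← Finset.sum_mul]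
  simp only [mul_add, Finset.sum_add_distrib, mul_ite, mul_one, mul_zero, Finset.sum_ite_eq', hk,
    hk', if_true]
  -- By symmetry of the weight the two pairings contribute equally, and their sum cancels the factor
  -- `1/2`.
  have hsw : w k.swap = w k := mul_comm _ _
  rw [hsw]
  simp only [hw]
  push_cast
  ring

/-! ### The constant `c₂₂` -/

/-- Centring cancels the pairing that contracts modes at equal times, leaving the cross pairing,
which forces `l = k.swap`. -/
theorem integral_wick_mul_wick (hz : IsStochConvVersion P μ ξ z)
    (hξ : IsComplexWhiteNoise P ξ) (hμ : 0 < μ) (k l : Z3 × Z3) {s t : ℝ} (hst : s ≤ t) :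
    ∫ ω, (z k.1 s ω * conj (z k.2 s ω) - modeCov μ k.1 k.2) *
        (z l.1 t ω * conj (z l.2 t ω) - modeCov μ l.1 l.2) ∂P =
      (if l = k.swap then 1 else 0) * (1 / (4 * symbRe μ k.1 * symbRe μ k.2) *
          Complex.exp (-((conj (symb μ k.1) + symb μ k.2) * (t - s : ℝ)))) := by
  have i4 := integrable_mul_four (hz.memLp_four hξ hμ k.1 s) (hz.memLp_four hξ hμ l.1 t)
    (hz.memLp_four hξ hμ k.2 s) (hz.memLp_four hξ hμ l.2 t)
  have i2 := fun (k : Z3 × Z3) s => (hz.memLp_mul_conj hξ hμ k.1 k.2 s).integrable one_le_two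
  have e : ∀ ω, (z k.1 s ω * conj (z k.2 s ω) - modeCov μ k.1 k.2) *
        (z l.1 t ω * conj (z l.2 t ω) - modeCov μ l.1 l.2) =
      z k.1 s ω * z l.1 t ω * conj (z k.2 s ω) * conj (z l.2 t ω)
        - modeCov μ l.1 l.2 * (z k.1 s ω * conj (z k.2 s ω))
        - modeCov μ k.1 k.2 * (z l.1 t ω * conj (z l.2 t ω))
        + modeCov μ k.1 k.2 * modeCov μ l.1 l.2 := fun ω => by ring
  -- The covariance formula wants the unconjugated factor at the earlier time. Here it is at the
  -- later one, which is why `symb μ k.2` appears without conjugation.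
  have hconj : ∫ ω, z l.1 t ω * conj (z k.2 s ω) ∂P =
      conj (∫ ω, z k.2 s ω * conj (z l.1 t ω) ∂P) := by
    rw [← integral_conj]
    congr 1
    ext ω
    rw [map_mul, Complex.conj_conj, mul_comm]
  have h := hz.wick hξ hμ (k.1, s) (l.1, t) (k.2, s) (l.2, t)
  simp only [hconj, hz.integral_mul_conj hξ hμ _ _ hst, hz.integral_mul_conj_self hξ hμ] at h
  simp_rw [e]
  have j1 : Integrable (fun ω => z k.1 s ω * z l.1 t ω * conj (z k.2 s ω) * conj (z l.2 t ω)
      - modeCov μ l.1 l.2 * (z k.1 s ω * conj (z k.2 s ω))) P := i4.sub ((i2 k s).const_mul _)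
  have j2 : Integrable (fun ω => z k.1 s ω * z l.1 t ω * conj (z k.2 s ω) * conj (z l.2 t ω)
      - modeCov μ l.1 l.2 * (z k.1 s ω * conj (z k.2 s ω))
      - modeCov μ k.1 k.2 * (z l.1 t ω * conj (z l.2 t ω))) P := j1.sub ((i2 l t).const_mul _)
  rw [integral_add j2 (integrable_const _), integral_sub j1 ((i2 l t).const_mul _),
    integral_sub i4 ((i2 k s).const_mul _), integral_const_mul, integral_const_mul,
    hz.integral_mul_conj_self hξ hμ, hz.integral_mul_conj_self hξ hμ, h, integral_const]
  have ee : Complex.exp (-((conj (symb μ k.1) + symb μ k.2) * (t - s : ℝ))) =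
      Complex.exp (-(conj (symb μ k.1) * (t - s : ℝ))) *
        Complex.exp (-(symb μ k.2 * (t - s : ℝ))) := by
    rw [← Complex.exp_add]; congr 1; ring
  rw [ee]
  by_cases hl : l = k.swap
  · subst hl
    simp [← Complex.exp_conj, Complex.conj_ofNat]
    ring
  · have hl' : ¬ (k.1 = l.2 ∧ k.2 = l.1) := fun h => hl (Prod.ext h.2.symm h.1.symm)
    rw [if_neg hl]
    by_cases h1 : k.1 = l.2
    · have h2 : k.2 ≠ l.1 := fun h2 => hl' ⟨h1, h2⟩
      simp [h2]
      ring
    · simp [h1]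
      ring

theorem resIABAB_expectation (hz : IsStochConvVersion P μ ξ z) (hξ : IsComplexWhiteNoise P ξ)
    (hμ : 0 < μ) (hS : ∀ k ∉ S, chiEps χ ε k = 0) {ρ : ℕ → R3 → ℝ} (hρ : IsDyadicPartition ρ)
    (t : ℝ) (x : T3) :
    Integrable (resIABAB P μ χ ε z ρ t x) P ∧
    c22 P μ χ ε z ρ t x = ∑ k ∈ S ×ˢ S, ((chiEps χ ε k.1 : ℂ) * chiEps χ ε k.2) ^ 2 /
      (4 * symbRe μ k.1 * symbRe μ k.2 * (α₂ μ k.1 k.2 + Complex.I * β₂ k.1 k.2)) := by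
  set w : Z3 × Z3 → ℝ := fun k => chiEps χ ε k.1 * chiEps χ ε k.2 with hw
  set y : Z3 × Z3 → ℝ → Ω → ℂ :=
    fun k s ω => z k.1 s ω * conj (z k.2 s ω) - modeCov μ k.1 k.2 with hy
  have hE : ∀ k l : Z3 × Z3, ∀ s ≤ t, ∫ ω, (w k * y k s ω) * (w l * y l t ω) ∂P =
        ((w k : ℂ) * w l * (if l = k.swap then 1 else 0) *
          (1 / (4 * symbRe μ k.1 * symbRe μ k.2))) *
          Complex.exp (-((conj (symb μ k.1) + symb μ k.2) * (t - s : ℝ))) := by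
    intro k l s hs
    simp only [mul_mul_mul_comm (w k : ℂ) _ (w l : ℂ) _]
    rw [integral_const_mul, hz.integral_wick_mul_wick hξ hμ k l hs]
    ring
  have hyL : ∀ k s, MemLp (y k s) 2 P := fun k s =>
    (hz.memLp_mul_conj hξ hμ k.1 k.2 s).sub (memLp_const _)
  have hyC : ∀ k s, ∫ ω, ‖y k s ω‖ ^ 2 ∂P ≤ 2 + 2 * ‖modeCov μ k.1 k.2‖ ^ 2 := fun k s => by
    have hi := hz.integrable_sq_mul_sq hξ hμ k.1 k.2 s
    calc ∫ ω, ‖y k s ω‖ ^ 2 ∂P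
        ≤ ∫ ω, (2 * (‖z k.1 s ω‖ ^ 2 * ‖z k.2 s ω‖ ^ 2) + 2 * ‖modeCov μ k.1 k.2‖ ^ 2) ∂P := by
          refine integral_mono ((memLp_two_iff_integrable_sq_norm
            (hyL k s).aestronglyMeasurable).1 (hyL k s))
            ((hi.const_mul 2).add (integrable_const _)) fun ω => ?_
          have h1 := norm_sub_le (z k.1 s ω * conj (z k.2 s ω)) (modeCov μ k.1 k.2)
          have h2 : ‖z k.1 s ω * conj (z k.2 s ω)‖ ^ 2 = ‖z k.1 s ω‖ ^ 2 * ‖z k.2 s ω‖ ^ 2 := by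
            rw [norm_mul, Complex.norm_conj, mul_pow]
          simp only [hy, ← h2]
          nlinarith [norm_nonneg (z k.1 s ω * conj (z k.2 s ω) - modeCov μ k.1 k.2),
            sq_nonneg (‖z k.1 s ω * conj (z k.2 s ω)‖ - ‖modeCov μ k.1 k.2‖)]
      _ = 2 * (∫ ω, ‖z k.1 s ω‖ ^ 2 * ‖z k.2 s ω‖ ^ 2 ∂P) + 2 * ‖modeCov μ k.1 k.2‖ ^ 2 := by
          rw [integral_add (hi.const_mul 2) (integrable_const _), integral_const_mul]
          simp
      _ ≤ _ := by linarith [hz.integral_sq_mul_sq_le hξ hμ k.1 k.2 s]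
  have key := integral_resonant_duhamel (P := P) hρ hμ t x (S ×ˢ S) (S ×ˢ S)
    (fun k => k.1 - k.2) (fun k => k.1 - k.2)
    (a := fun k s ω => w k * y k s ω) (b := fun l ω => w l * y l t ω)
    (C := fun k => ‖(w k : ℂ)‖ ^ 2 * (2 + 2 * ‖modeCov μ k.1 k.2‖ ^ 2))
    (fun k => measurable_const.mul (((hz.measurable k.1).mul
      (Complex.continuous_conj.measurable.comp (hz.measurable k.2))).sub measurable_const))
    (fun k s => (hyL k s).const_mul _)
    (fun k s => by
      simp only [norm_mul, mul_pow]
      rw [integral_const_mul]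
      exact mul_le_mul_of_nonneg_left (hyC k s) (by positivity))
    (fun l => (hyL l t).const_mul _)
    (fun k l s hs hp => by
      rw [hE k l s hs]
      -- Swapping a pair negates the difference `k.1 - k.2`, so the surviving pairing again has
      -- opposite frequencies.
      have h2 : l ≠ k.swap := by rintro rfl; exact hp (by simp)
      simp [h2])
    (F := XAB P χ ε z) (fun ω s x => hz.XAB_eq_sum hξ hμ hS ω s x)
    (G := fun ω => XAB P χ ε z ω t) (fun ω x => hz.XAB_eq_sum hξ hμ hS ω t x)
  refine ⟨key.1, ?_⟩
  change ∫ ω, resonant ρ (duhamel μ (XAB P χ ε z ω) t) (XAB P χ ε z ω t) x ∂P = _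
  rw [key.2]
  refine Finset.sum_congr rfl fun k hk => ?_
  obtain ⟨d, hd⟩ : ∃ d : ℂ, α₂ μ k.1 k.2 + Complex.I * β₂ k.1 k.2 = d := ⟨_, rfl⟩
  rw [hd]
  have hk' : k.swap ∈ S ×ˢ S := by
    rw [Finset.mem_product] at hk ⊢; exact ⟨hk.2, hk.1⟩
  have hpos : 0 < (conj (symb μ k.1) + symb μ k.2).re := by
    rw [Complex.add_re, Complex.conj_re, symb_re, symb_re]
    linarith [one_le_symbRe hμ k.1, one_le_symbRe hμ k.2]
  have hint : ∀ l, ∫ s in Set.Iic t, h μ (t - s) (k.1 - k.2) *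
      ∫ ω, (w k * y k s ω) * (w l * y l t ω) ∂P =
        ((w k : ℂ) * w l * (if l = k.swap then 1 else 0) *
          (1 / (4 * symbRe μ k.1 * symbRe μ k.2))) / d := by
    intro l
    refine (setIntegral_congr_fun measurableSet_Iic fun s hs =>
      congrArg (h μ (t - s) _ * ·) (hE k l s hs)).trans ?_
    rw [integral_h_mul_exp hμ _ hpos, symb_add_eq_α₂_β₂, hd]
  simp only [hint]
  rw [← Finset.sum_div, ← Finset.sum_mul]
  simp only [mul_ite, mul_one, mul_zero, Finset.sum_ite_eq', hk', if_true]
  have hsw : w k.swap = w k := mul_comm _ _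
  rw [hsw]
  simp only [hw]
  push_cast
  ring

end IsStochConvVersion

end Drivers

end CGL

theorem mainTheorem9 {Ω : Type*} [MeasurableSpace Ω] (P : Measure Ω) [IsProbabilityMeasure P]
    (ξ : (ℝ × CGL.T3 → ℂ) → Ω → ℂ) (hξ : CGL.IsComplexWhiteNoise P ξ)
    (μ : ℝ) (hμ : 0 < μ)
    (z : CGL.Z3 → ℝ → Ω → ℂ) (hz : CGL.IsStochConvVersion P μ ξ z)
    (χ : CGL.R3 → ℝ) (hχ : CGL.IsCutoff χ)
    (ε : ℝ) (hε0 : 0 < ε) (hε1 : ε < 1) :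
    -- the formula for `c₁^ε`
    (∀ (t : ℝ) (x : CGL.T3),
      Integrable (fun ω => CGL.XA χ ε z ω t x * CGL.XB χ ε z ω t x) P ∧
      HasSum (fun k : CGL.Z3 =>
          (CGL.chiEps χ ε k : ℂ) ^ 2 / (2 * (4 * Real.pi ^ 2 * μ * CGL.normSq k + 1)))
        (CGL.c1 P χ ε z t x)) ∧
    -- the formula for `c_{2,1}^ε`
    (∀ ρ : ℕ → CGL.R3 → ℝ, CGL.IsDyadicPartition ρ → ∀ (t : ℝ) (x : CGL.T3),
      Integrable (CGL.resIAABB μ χ ε z ρ t x) P ∧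
      HasSum (fun k : CGL.Z3 × CGL.Z3 =>
          ((CGL.chiEps χ ε k.1 : ℂ) * CGL.chiEps χ ε k.2) ^ 2 /
            (4 * (4 * Real.pi ^ 2 * μ * CGL.normSq k.1 + 1) *
              (4 * Real.pi ^ 2 * μ * CGL.normSq k.2 + 1) *
              (CGL.α₁ μ k.1 k.2 + Complex.I * CGL.β₁ k.1 k.2)))
        (CGL.c21 P μ χ ε z ρ t x)) ∧
    -- the formula for `c_{2,2}^ε`
    (∀ ρ : ℕ → CGL.R3 → ℝ, CGL.IsDyadicPartition ρ → ∀ (t : ℝ) (x : CGL.T3),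
      Integrable (CGL.resIABAB P μ χ ε z ρ t x) P ∧
      HasSum (fun k : CGL.Z3 × CGL.Z3 =>
          ((CGL.chiEps χ ε k.1 : ℂ) * CGL.chiEps χ ε k.2) ^ 2 /
            (4 * (4 * Real.pi ^ 2 * μ * CGL.normSq k.1 + 1) *
              (4 * Real.pi ^ 2 * μ * CGL.normSq k.2 + 1) *
              (CGL.α₂ μ k.1 k.2 + Complex.I * CGL.β₂ k.1 k.2)))
        (CGL.c22 P μ χ ε z ρ t x)) ∧
    -- the constants depend neither on `(t,x)` nor on the partition of unity
    (∀ (t t' : ℝ) (x x' : CGL.T3), CGL.c1 P χ ε z t x = CGL.c1 P χ ε z t' x') ∧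
    (∀ ρ ρ' : ℕ → CGL.R3 → ℝ, CGL.IsDyadicPartition ρ → CGL.IsDyadicPartition ρ' →
      ∀ (t t' : ℝ) (x x' : CGL.T3),
        CGL.c21 P μ χ ε z ρ t x = CGL.c21 P μ χ ε z ρ' t' x' ∧
        CGL.c22 P μ χ ε z ρ t x = CGL.c22 P μ χ ε z ρ' t' x') := by
  obtain ⟨S, hS⟩ := CGL.exists_finset_chiEps_eq_zero hχ hε0
  -- Terms outside the finite frequency set vanish, which turns the finite formulas into sums over
  -- the whole lattice.
  have hS' : ∀ k ∉ S ×ˢ S, (CGL.chiEps χ ε k.1 : ℂ) * CGL.chiEps χ ε k.2 = 0 := by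
    intro k hk
    rw [Finset.mem_product, not_and_or] at hk
    rcases hk with hk | hk <;> simp [hS _ hk]
  have h1 := hz.c1_eq hξ hμ hS
  have h21 := fun ρ (hρ : CGL.IsDyadicPartition ρ) => hz.resIAABB_expectation hξ hμ hS hρ
  have h22 := fun ρ (hρ : CGL.IsDyadicPartition ρ) => hz.resIABAB_expectation hξ hμ hS hρ
  refine ⟨fun t x => ⟨hz.integrable_XA_mul_XB hξ hμ hS t x, ?_⟩,
    fun ρ hρ t x => ⟨(h21 ρ hρ t x).1, ?_⟩, fun ρ hρ t x => ⟨(h22 ρ hρ t x).1, ?_⟩,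
    fun t t' x x' => by rw [h1, h1], fun ρ ρ' hρ hρ' t t' x x' => ⟨?_, ?_⟩⟩
  · rw [h1]
    simp only [CGL.symbRe]
    push_cast
    exact hasSum_sum_of_ne_finset_zero fun k hk => by simp [hS k hk]
  · rw [(h21 ρ hρ t x).2]
    simp only [CGL.symbRe]
    push_cast
    exact hasSum_sum_of_ne_finset_zero fun k hk => by rw [hS' k hk]; simp
  · rw [(h22 ρ hρ t x).2]
    simp only [CGL.symbRe]
    push_cast
    exact hasSum_sum_of_ne_finset_zero fun k hk => by rw [hS' k hk]; simp
  · rw [(h21 ρ hρ t x).2, (h21 ρ' hρ' t' x').2]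
  · rw [(h22 ρ hρ t x).2, (h22 ρ' hρ' t' x').2]
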